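/- Let $\Omega_0\subset\Omega\subset\mathbb{C}$ with $\Omega_0$ closed and $\Omega$ open, let $f$ be analytic on $\Omega\setminus\Omega_0$, and let $z_1\in\Omega_0$, $z_2\in\Omega\setminus\Omega_0$. For a set $P\subset\Omega\setminus\Omega_0$ call a pair $(\Gamma_1,\Gamma_2)$ of piecewise $C^1$ simple closed loops, contained in $\Omega\setminus\Omega_0$ and traversed counterclockwise, *admissible for $P$* if $\Gamma_2$ encircles $\Omega_0$, no point of $P$ lies on or inside $\Gamma_2$, $\Gamma_1$ encircles $\Gamma_2$ and the points of $P$, and the region inside $\Gamma_1$ is contained in $\Omega$. Suppose that there is an admissible pair $(\Gamma_1,\Gamma_2)$ for $\{z_2\}$, and for $n=0,1,2,\dots$ put $$d_n(z_1,z_2)=\frac{1}{2\pi i(z_2-z_1)}\int_{\Gamma_1}\frac{f(w)\,dw}{(w-z_1)^n(w-z_2)^{n+1}},\qquad e_n(z_1,z_2)=\frac{z_1-z_2}{2\pi i}\int_{\Gamma_2}\frac{(w-z_1)^n}{(w-z_2)^{n+1}}f(w)\,dw,$$ and let $d_n(z_2,z_1)$ be given by the first formula with $z_1$ and $z_2$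 interchanged (and the same contour $\Gamma_1$). Then: (i) These coefficients do not depend on the choice of the admissible pair for $\{z_2\}$. (ii) For every $z\in\Omega\setminus\Omega_0$, every pair $(\Gamma_1,\Gamma_2)$ that is admissible for $\{z,z_2\}$ and every $N\ge 0$, $$f(z)=\sum_{n=0}^{N-1}\left[d_n(z_1,z_2)(z-z_1)+d_n(z_2,z_1)(z-z_2)\right](z-z_1)^n(z-z_2)^n+\sum_{n=0}^{N-1}e_n(z_1,z_2)(z-z_2)^n(z-z_1)^{-n-1}+r_N(z_1,z_2;z),$$ where $$r_N(z_1,z_2;z)=\frac{1}{2\pi i}\int_{\Gamma_1}\frac{f(w)\,dw}{(w-z_1)^N(w-z_2)^N(w-z)}\,(z-z_1)^N(z-z_2)^N-\frac{1}{2\pi i}\int_{\Gamma_2}\frac{(w-z_1)^Nf(w)\,dw}{(w-z_2)^N(w-z)}\,\frac{(z-z_2)^N}{(z-z_1)^N}.$$ (iii) Let $r_1=\inf_{w\in\mathbb{C}\setminus\Omega}|(w-z_1)(w-z_2)|$ (with $r_1=\infty$ if $\Omega=\mathbb{C}$) and $r_2=\inf_{w\in\Omega_0}|w-z_2|/|w-z_1|$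 (the quotient being $\infty$ at $w=z_1$). For every $z\in\Omega\setminus\Omega_0$ with $|(z-z_1)(z-z_2)|<r_1$ and $|z-z_2|<r_2|z-z_1|$ the expansion converges to $f(z)$: the two infinite series $$\sum_{n=0}^{\infty}\left[d_n(z_1,z_2)(z-z_1)+d_n(z_2,z_1)(z-z_2)\right](z-z_1)^n(z-z_2)^n,\qquad \sum_{n=0}^{\infty}e_n(z_1,z_2)(z-z_2)^n(z-z_1)^{-n-1}$$ converge absolutely, their sum is $f(z)$, and $r_N(z_1,z_2;z)\to 0$ as $N\to\infty$ for every pair of contours admissible for $\{z,z_2\}$. -/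

import Mathlib

open Set Filter Topology

noncomputable section

/-- The contour integral `∫_γ g(w) dw` along a curve parametrized by `[0, 1]`. -/
def contourIntegral (g : ℂ → ℂ) (γ : ℝ → ℂ) : ℂ :=
  ∫ t in (0 : ℝ)..1, g (γ t) * deriv γ t

/-- The trace of a curve parametrized by `[0, 1]`. -/
def trace (γ : ℝ → ℂ) : Set ℂ := γ '' Icc 0 1

/-- The winding number of `γ` around `p`. -/
def windingNumber (γ : ℝ → ℂ) (p : ℂ) : ℂ :=
  (2 * Real.pi * Complex.I)⁻¹ * contourIntegral (fun w => (w - p)⁻¹) γ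

/-- The points inside a closed curve: those off the curve around which it winds. For a simple
closed curve this is the bounded component of the complement of its trace. -/
def inside (γ : ℝ → ℂ) : Set ℂ := {p | p ∉ trace γ ∧ windingNumber γ p ≠ 0}

/-- A piecewise continuously differentiable simple closed loop, parametrized by `[0, 1]` and
traversed in the counterclockwise direction (it winds once, positively, around each point that is
inside it). The finite set `s` contains the break points of the parametrization. -/
structure IsSimpleLoop (γ : ℝ → ℂ) : Prop where
  continuousOn : ContinuousOn γ (Icc 0 1)
  piecewise : ∃ s : Finset ℝ, ∀ a b : ℝ, 0 ≤ a → a < b → b ≤ 1 → Disjoint (Ioo a b) (s : Set ℝ) →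
    ContDiffOn ℝ 1 γ (Icc a b)
  closed : γ 0 = γ 1
  simple : InjOn γ (Ico 0 1)
  counterclockwise : ∀ p ∈ inside γ, windingNumber γ p = 1

/-- Admissible contours: `Γ₁`, `Γ₂` are counterclockwise simple closed loops in `Ω \ Ω₀`
encircling `Ω₀`; no point of `P` lies on or inside `Γ₂`; `Γ₁` encircles `Γ₂` and the points of
`P`, and the region enclosed by `Γ₁` is part of `Ω`. -/
structure AdmissibleContours (Ω Ω₀ P : Set ℂ) (Γ₁ Γ₂ : ℝ → ℂ) : Prop where
  loop₁ : IsSimpleLoop Γ₁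
  loop₂ : IsSimpleLoop Γ₂
  trace₁ : trace Γ₁ ⊆ Ω \ Ω₀
  trace₂ : trace Γ₂ ⊆ Ω \ Ω₀
  encircle₂ : Ω₀ ⊆ inside Γ₂
  encircle₁ : trace Γ₂ ∪ inside Γ₂ ⊆ inside Γ₁
  points₁ : P ⊆ inside Γ₁
  points₂ : Disjoint P (trace Γ₂ ∪ inside Γ₂)
  inside₁ : inside Γ₁ ⊆ Ω

/-- The coefficient `d_n(z₁, z₂)`, computed on the contour `Γ`. -/
def dCoeff (f : ℂ → ℂ) (Γ : ℝ → ℂ) (z₁ z₂ : ℂ) (n : ℕ) : ℂ :=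
  1 / (2 * Real.pi * Complex.I * (z₂ - z₁)) *
    contourIntegral (fun w => f w / ((w - z₁) ^ n * (w - z₂) ^ (n + 1))) Γ

/-- The coefficient `e_n(z₁, z₂)`, computed on the contour `Γ`. -/
def eCoeff (f : ℂ → ℂ) (Γ : ℝ → ℂ) (z₁ z₂ : ℂ) (n : ℕ) : ℂ :=
  (z₁ - z₂) / (2 * Real.pi * Complex.I) *
    contourIntegral (fun w => (w - z₁) ^ n / (w - z₂) ^ (n + 1) * f w) Γ

/-- The `n`-th term of the two-point Taylor part, with coefficients computed on `Γ`. -/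
def taylorTerm (f : ℂ → ℂ) (Γ : ℝ → ℂ) (z₁ z₂ z : ℂ) (n : ℕ) : ℂ :=
  (dCoeff f Γ z₁ z₂ n * (z - z₁) + dCoeff f Γ z₂ z₁ n * (z - z₂)) *
    ((z - z₁) ^ n * (z - z₂) ^ n)

/-- The `n`-th term `e_n (z - z₂)^n (z - z₁)^(-n-1)`, with `e_n` computed on `Γ`. -/
def laurentTerm (f : ℂ → ℂ) (Γ : ℝ → ℂ) (z₁ z₂ z : ℂ) (n : ℕ) : ℂ :=
  eCoeff f Γ z₁ z₂ n * ((z - z₂) ^ n / (z - z₁) ^ (n + 1))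

/-- The remainder `r_N(z₁, z₂; z)`, computed on the contours `Γ₁`, `Γ₂`. -/
def remainder (f : ℂ → ℂ) (Γ₁ Γ₂ : ℝ → ℂ) (z₁ z₂ z : ℂ) (N : ℕ) : ℂ :=
  1 / (2 * Real.pi * Complex.I) *
      contourIntegral (fun w => f w / ((w - z₁) ^ N * (w - z₂) ^ N * (w - z))) Γ₁ *
      ((z - z₁) ^ N * (z - z₂) ^ N) -
    1 / (2 * Real.pi * Complex.I) *
      contourIntegral (fun w => (w - z₁) ^ N * f w / ((w - z₂) ^ N * (w - z))) Γ₂ *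
      ((z - z₂) ^ N / (z - z₁) ^ N)

/-- `r₁ = inf { |(w - z₁)(w - z₂)| : w ∉ Ω }`, which is `∞` if `Ω` is the whole plane. -/
def cassiniRadius (Ω : Set ℂ) (z₁ z₂ : ℂ) : ENNReal :=
  ⨅ w ∈ Ωᶜ, ‖(w - z₁) * (w - z₂)‖ₑ

/-- `r₂ = inf { |w - z₂| / |w - z₁| : w ∈ Ω₀ }`; the quotient is `∞` at `w = z₁ ≠ z₂`. -/
def quotientRadius (Ω₀ : Set ℂ) (z₁ z₂ : ℂ) : ENNReal :=
  ⨅ w ∈ Ω₀, ‖w - z₂‖ₑ / ‖w - z₁‖ₑ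

/-- The region of convergence `D_{z₁, z₂}`. -/
def convergenceRegion (Ω Ω₀ : Set ℂ) (z₁ z₂ : ℂ) : Set ℂ :=
  {z | z ∈ Ω \ Ω₀ ∧ ‖(z - z₁) * (z - z₂)‖ₑ < cassiniRadius Ω z₁ z₂ ∧
    ‖z - z₂‖ₑ < quotientRadius Ω₀ z₁ z₂ * ‖z - z₁‖ₑ}

end

/-! The finite expansion is Cauchy's formula for the cycle Γ₁ − Γ₂ in Ω ∖ Ω₀ with finite geometric
sums in place of the kernel 1/(w − z): on Γ₁ the ratio is (z − z₁)(z − z₂)/((w − z₁)(w − z₂)), on Γ₂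
it is (w − z₁)(z − z₂)/((w − z₂)(z − z₁)). Cauchy's theorem is proved in homology form by Dixon's
argument (`dixon`), which needs only winding numbers and no Jordan curve theorem; it also gives
independence of the contours.

Convergence is not obtained by estimating the remainder on contours close to the boundary. Instead f
= F₁ + F₂ with F₁ holomorphic on Ω and F₂ off Ω₀ (`exists_splitting`), and each series is recognised
as a power series of one variable u.

For F₁ put u = (z − z₁)(z − z₂). Splitting into even and odd parts about the midpoint m = (z₁ +
z₂)/2 gives F₁(z) = A(u) + (z − m)B(u) with A, B holomorphic for |u| < R, where R < r₁
(`exists_even_add_odd`); the d_n are Taylor coefficients of combinations of A and B. For F₂ put u =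
(z − z₂)/(z − z₁); then (z − z₁)F₂(z) is holomorphic in u for |u| < R, R < r₂, including u = 1 (z =
∞), with Taylor coefficients e_n. Both identifications are made for small u only, on the given
contours, and reach the full disc by uniqueness of Taylor coefficients
(`hasSum_of_eventually_hasSum`). The remainder, being f minus the partial sums, then tends to 0. -/

open MeasureTheory

/-! ### Integrability along piecewise C¹ loops -/

namespace IsSimpleLoop

variable {γ : ℝ → ℂ}

theorem integrableOn_deriv_of_contDiffOn {a b : ℝ} (hab : a < b)
    (h : ContDiffOn ℝ 1 γ (Icc a b)) : IntegrableOn (deriv γ) (Icc a b) := by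
  have h1 : ContinuousOn (derivWithin γ (Icc a b)) (Icc a b) :=
    h.continuousOn_derivWithin (uniqueDiffOn_Icc hab) le_rfl
  have h2 : IntegrableOn (derivWithin γ (Icc a b)) (Icc a b) := h1.integrableOn_compact isCompact_Icc
  -- At the endpoints `deriv γ` need not be the one-sided derivative; these two points form a null
  -- set.
  rw [integrableOn_Icc_iff_integrableOn_Ioo] at h2 ⊢
  refine h2.congr_fun (fun t ht => ?_) measurableSet_Ioo
  exact derivWithin_of_mem_nhds (Icc_mem_nhds ht.1 ht.2)

theorem integrableOn_deriv (hγ : IsSimpleLoop γ) : IntegrableOn (deriv γ) (Icc 0 1) := by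
  obtain ⟨s, hs⟩ := hγ.piecewise
  have hloc : LocallyIntegrableOn (deriv γ) (Icc 0 1) := by
    intro x hx
    have hev : ∀ᶠ y in 𝓝[≠] x, y ∉ (s : Set ℝ) := by
      have : IsClosed ((s : Set ℝ) \ {x}) := (s.finite_toSet.subset sdiff_subset).isClosed
      have h2 : ((s : Set ℝ) \ {x})ᶜ ∈ 𝓝 x := this.isOpen_compl.mem_nhds (by simp)
      filter_upwards [mem_nhdsWithin_of_mem_nhds h2, self_mem_nhdsWithin] with y hy hyx hys
      exact hy ⟨hys, hyx⟩
    rw [eventually_nhdsWithin_iff, Metric.eventually_nhds_iff] at hev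
    obtain ⟨ε, hε, hev⟩ := hev
    -- The last alternative keeps x, possibly a break point, out of the open interval (a, b); no
    -- other break point lies within ε of x.
    have key : ∀ a b : ℝ, 0 ≤ a → b ≤ 1 → x - ε ≤ a → b ≤ x + ε → (b ≤ x ∨ x ≤ a) →
        IntegrableOn (deriv γ) (Icc a b) := by
      intro a b ha hb hax hbx hor
      rcases lt_trichotomy a b with hab | hab | hab
      · refine integrableOn_deriv_of_contDiffOn hab (hs a b ha hab hb ?_)
        rw [Set.disjoint_left]
        intro y hy hys
        refine hev ?_ ?_ hys
        · rw [Real.dist_eq, abs_lt]; constructor <;> linarith [hy.1, hy.2]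
        · rintro rfl
          rcases hor with h | h <;> linarith [hy.1, hy.2]
      · subst hab; simp
      · rw [Icc_eq_empty (not_le.2 hab)]; exact integrableOn_empty
    refine ⟨Icc (max 0 (x - ε)) x ∪ Icc x (min 1 (x + ε)), ?_, ?_⟩
    · have : Ioo (x - ε) (x + ε) ∈ 𝓝 x := Ioo_mem_nhds (by linarith) (by linarith)
      filter_upwards [mem_nhdsWithin_of_mem_nhds this, self_mem_nhdsWithin] with y hy hy1
      rcases le_total y x with h | h
      · exact Or.inl ⟨max_le hy1.1 hy.1.le, h⟩
      · exact Or.inr ⟨h, le_min hy1.2 hy.2.le⟩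
    · exact (key _ _ (le_max_left _ _) hx.2 (le_max_right _ _) (by linarith) (Or.inl le_rfl)).union
        (key _ _ hx.1 (min_le_left _ _) (by linarith) (min_le_right _ _) (Or.inr le_rfl))
  exact hloc.integrableOn_isCompact isCompact_Icc

theorem intervalIntegrable_deriv (hγ : IsSimpleLoop γ) :
    IntervalIntegrable (deriv γ) volume 0 1 :=
  (intervalIntegrable_iff_integrableOn_Icc_of_le zero_le_one).2 hγ.integrableOn_deriv

theorem isCompact_trace (hγ : IsSimpleLoop γ) : IsCompact (trace γ) :=
  isCompact_Icc.image_of_continuousOn hγ.continuousOn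

theorem mapsTo_trace : MapsTo γ (Icc 0 1) (trace γ) := fun _ ht => mem_image_of_mem _ ht

theorem mem_trace {t : ℝ} (ht : t ∈ uIoc (0 : ℝ) 1) : γ t ∈ trace γ := by
  rw [uIoc_of_le zero_le_one] at ht
  exact mem_image_of_mem _ (Ioc_subset_Icc_self ht)

theorem intervalIntegrable_mul_deriv (hγ : IsSimpleLoop γ) {g : ℂ → ℂ}
    (hg : ContinuousOn g (trace γ)) :
    IntervalIntegrable (fun t => g (γ t) * deriv γ t) volume 0 1 := by
  refine hγ.intervalIntegrable_deriv.continuousOn_mul ?_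
  rw [uIcc_of_le zero_le_one]
  exact hg.comp hγ.continuousOn mapsTo_trace

end IsSimpleLoop

/-! ### Contour integrals: linearity, bounds, series and parameters -/

section contourIntegral

variable {γ : ℝ → ℂ}

theorem contourIntegral_congr {g h : ℂ → ℂ} (H : EqOn g h (trace γ)) :
    contourIntegral g γ = contourIntegral h γ := by
  refine intervalIntegral.integral_congr fun t ht => ?_
  rw [uIcc_of_le zero_le_one] at ht
  simp only [H (mem_image_of_mem _ ht)]

theorem contourIntegral_const_mul (c : ℂ) (g : ℂ → ℂ) :
    contourIntegral (fun w => c * g w) γ = c * contourIntegral g γ := by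
  simp only [contourIntegral, mul_assoc, intervalIntegral.integral_const_mul]

theorem contourIntegral_mul_const (c : ℂ) (g : ℂ → ℂ) :
    contourIntegral (fun w => g w * c) γ = contourIntegral g γ * c := by
  simp only [mul_comm _ c, contourIntegral_const_mul]

theorem contourIntegral_add (hγ : IsSimpleLoop γ) {g h : ℂ → ℂ} (hg : ContinuousOn g (trace γ))
    (hh : ContinuousOn h (trace γ)) :
    contourIntegral (fun w => g w + h w) γ = contourIntegral g γ + contourIntegral h γ := by
  simp only [contourIntegral, add_mul]
  exact intervalIntegral.integral_add (hγ.intervalIntegrable_mul_deriv hg)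
    (hγ.intervalIntegrable_mul_deriv hh)

theorem contourIntegral_sub (hγ : IsSimpleLoop γ) {g h : ℂ → ℂ} (hg : ContinuousOn g (trace γ))
    (hh : ContinuousOn h (trace γ)) :
    contourIntegral (fun w => g w - h w) γ = contourIntegral g γ - contourIntegral h γ := by
  simp only [contourIntegral, sub_mul]
  exact intervalIntegral.integral_sub (hγ.intervalIntegrable_mul_deriv hg)
    (hγ.intervalIntegrable_mul_deriv hh)

theorem contourIntegral_sum (hγ : IsSimpleLoop γ) {ι : Type*} (s : Finset ι) {g : ι → ℂ → ℂ}
    (hg : ∀ i ∈ s, ContinuousOn (g i) (trace γ)) :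
    contourIntegral (fun w => ∑ i ∈ s, g i w) γ = ∑ i ∈ s, contourIntegral (g i) γ := by
  simp only [contourIntegral, Finset.sum_mul]
  exact intervalIntegral.integral_finsetSum fun i hi => hγ.intervalIntegrable_mul_deriv (hg i hi)

/-- The length of a curve parametrized by `[0, 1]`. -/
noncomputable def curveLength (γ : ℝ → ℂ) : ℝ := ∫ t in (0 : ℝ)..1, ‖deriv γ t‖

theorem norm_contourIntegral_le (hγ : IsSimpleLoop γ) {g : ℂ → ℂ} {C : ℝ}
    (hC : ∀ w ∈ trace γ, ‖g w‖ ≤ C) : ‖contourIntegral g γ‖ ≤ C * curveLength γ := by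
  rw [contourIntegral, curveLength, ← intervalIntegral.integral_const_mul]
  refine intervalIntegral.norm_integral_le_of_norm_le zero_le_one (ae_of_all _ fun t ht => ?_)
    (hγ.intervalIntegrable_deriv.norm.const_mul C)
  rw [norm_mul]
  exact mul_le_mul_of_nonneg_right (hC _ (mem_image_of_mem _ (Ioc_subset_Icc_self ht)))
    (norm_nonneg _)

theorem hasSum_contourIntegral_geometric (hγ : IsSimpleLoop γ) {k q : ℂ → ℂ} {u : ℂ} {ρ : ℝ}
    (hk : ContinuousOn k (trace γ)) (hq : ContinuousOn q (trace γ)) (hρ : ρ < 1)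
    (hu : ∀ w ∈ trace γ, ‖u * q w‖ ≤ ρ) :
    HasSum (fun n : ℕ => u ^ n * contourIntegral (fun w => k w * q w ^ n) γ)
      (contourIntegral (fun w => k w * (1 - u * q w)⁻¹) γ) := by
  obtain ⟨M, hM⟩ := hγ.isCompact_trace.exists_bound_of_continuousOn hk
  have hρ0 : 0 ≤ ρ := (norm_nonneg _).trans (hu (γ 0) (mem_image_of_mem _ (by simp)))
  simp only [← contourIntegral_const_mul]
  refine intervalIntegral.hasSum_integral_of_dominated_convergence
    (fun n t => M * ρ ^ n * ‖deriv γ t‖) (fun n => ?_) (fun n => ae_of_all _ fun t ht => ?_)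
    (ae_of_all _ fun t ht => ?_) ?_ (ae_of_all _ fun t ht => ?_)
  · exact (intervalIntegrable_iff.1 (hγ.intervalIntegrable_mul_deriv
      (g := fun w => u ^ n * (k w * q w ^ n))
      (continuousOn_const.mul (hk.mul (hq.pow n))))).aestronglyMeasurable
  · have h1 := hM _ (IsSimpleLoop.mem_trace ht)
    have h2 := hu _ (IsSimpleLoop.mem_trace ht)
    rw [norm_mul]
    refine mul_le_mul_of_nonneg_right ?_ (norm_nonneg _)
    calc ‖u ^ n * (k (γ t) * q (γ t) ^ n)‖ = ‖k (γ t)‖ * ‖u * q (γ t)‖ ^ n := by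
          simp only [norm_mul, norm_pow]; ring
      _ ≤ M * ρ ^ n := by
          gcongr
          exact (norm_nonneg _).trans h1
  · exact ((summable_geometric_of_lt_one hρ0 hρ).mul_left M).mul_right _
  · simp only [tsum_mul_right]
    exact hγ.intervalIntegrable_deriv.norm.const_mul _
  · have h2 := hu _ (IsSimpleLoop.mem_trace ht)
    have := ((hasSum_geometric_of_norm_lt_one (h2.trans_lt hρ)).mul_left (k (γ t))).mul_right
      (deriv γ t)
    have e : (fun n => u ^ n * (k (γ t) * q (γ t) ^ n) * deriv γ t) =
        fun n => k (γ t) * (u * q (γ t)) ^ n * deriv γ t := by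
      funext n
      ring
    exact e ▸ this

/-- Differentiation under the integral sign; Cauchy's estimate on circles of radius r turns a bound
for φ on a compact set into the dominating bound for its derivative. -/
theorem differentiableOn_contourIntegral (hγ : IsSimpleLoop γ) {U : Set ℂ} (hU : IsOpen U)
    {φ : ℂ → ℂ → ℂ} (hc : ContinuousOn (Function.uncurry φ) (U ×ˢ trace γ))
    (hd : ∀ w ∈ trace γ, DifferentiableOn ℂ (fun z => φ z w) U) :
    DifferentiableOn ℂ (fun z => contourIntegral (φ z) γ) U := by
  intro z₀ hz₀
  obtain ⟨R, hR, hball⟩ := Metric.isOpen_iff.1 hU z₀ hz₀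
  have hcz : ∀ z ∈ U, ContinuousOn (φ z) (trace γ) := fun z hz =>
    hc.comp (continuousOn_const.prodMk continuousOn_id) fun w hw => ⟨hz, hw⟩
  -- Discs of radius r about points of the r-ball stay in the closed 2r-ball, which is compact and
  -- inside U.
  set r := R / 3 with hr
  have hr0 : 0 < r := by positivity
  have hsub : Metric.closedBall z₀ (2 * r) ⊆ U :=
    (Metric.closedBall_subset_ball (by linarith)).trans hball
  obtain ⟨M, hM⟩ := ((isCompact_closedBall z₀ (2 * r)).prod
    hγ.isCompact_trace).exists_bound_of_continuousOn (hc.mono (prod_mono hsub Subset.rfl))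
  have hsub' : ∀ x ∈ Metric.ball z₀ r, Metric.closedBall x r ⊆ Metric.closedBall z₀ (2 * r) := by
    intro x hx
    refine Metric.closedBall_subset_closedBall' ?_
    have := Metric.mem_ball.1 hx
    linarith
  have hmemU : ∀ x ∈ Metric.ball z₀ r, x ∈ U := fun x hx =>
    hsub (hsub' x hx (Metric.mem_closedBall_self hr0.le))
  have hderiv : ∀ x ∈ Metric.ball z₀ r, ∀ w ∈ trace γ,
      HasDerivAt (fun z => φ z w) (deriv (fun z => φ z w) x) x := fun x hx w hw =>
    ((hd w hw).differentiableAt (hU.mem_nhds (hmemU x hx))).hasDerivAt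
  have hmeas : ∀ x ∈ U, AEStronglyMeasurable (fun t => φ x (γ t) * deriv γ t)
      (volume.restrict (uIoc 0 1)) := fun x hx =>
    (intervalIntegrable_iff.1 (hγ.intervalIntegrable_mul_deriv (hcz x hx))).aestronglyMeasurable
  have main := intervalIntegral.hasDerivAt_integral_of_dominated_loc_of_deriv_le
    (F := fun z t => φ z (γ t) * deriv γ t)
    (F' := fun x t => deriv (fun z => φ z (γ t)) x * deriv γ t) (x₀ := z₀)
    (s := Metric.ball z₀ r) (μ := volume) (a := 0) (b := 1)
    (bound := fun t => M / r * ‖deriv γ t‖) (Metric.ball_mem_nhds z₀ hr0) ?_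
    (hγ.intervalIntegrable_mul_deriv (hcz z₀ hz₀)) ?_ (ae_of_all _ fun t ht x hx => ?_)
    (hγ.intervalIntegrable_deriv.norm.const_mul _) (ae_of_all _ fun t ht x hx => ?_)
  · exact main.2.differentiableAt.differentiableWithinAt
  · filter_upwards [hU.mem_nhds hz₀] with x hx using hmeas x hx
  · have hx : ∀ n : ℕ, z₀ + (r / (n + 2) : ℝ) ∈ Metric.ball z₀ r := by
      intro n
      rw [Metric.mem_ball, dist_eq_norm, add_sub_cancel_left, Complex.norm_real, Real.norm_eq_abs,
        abs_of_pos (by positivity), div_lt_iff₀ (by positivity)]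
      nlinarith [(Nat.cast_nonneg n : (0 : ℝ) ≤ n)]
    have hlim : Tendsto (fun n : ℕ => z₀ + (r / (n + 2) : ℝ)) atTop (𝓝[≠] z₀) := by
      refine tendsto_nhdsWithin_iff.2 ⟨?_, Eventually.of_forall fun n => ?_⟩
      · have : Tendsto (fun n : ℕ => r / ((n : ℝ) + 2)) atTop (𝓝 0) :=
          (tendsto_atTop_add_const_right _ _ tendsto_natCast_atTop_atTop).const_div_atTop r
        simpa using tendsto_const_nhds.add ((Complex.continuous_ofReal.tendsto 0).comp this)
      · have : (r / (n + 2) : ℝ) ≠ 0 := by positivity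
        simpa only [mem_compl_iff, mem_singleton_iff, add_eq_left, Complex.ofReal_eq_zero] using this
    refine aestronglyMeasurable_of_tendsto_ae atTop
      (f := fun (n : ℕ) t => slope (fun z => φ z (γ t)) z₀ (z₀ + (r / (n + 2) : ℝ)) * deriv γ t)
      (fun n => ?_) ?_
    · have h1 := ((hmeas _ (hmemU _ (hx n))).sub (hmeas z₀ hz₀)).const_mul
        ((z₀ + (r / (n + 2) : ℝ) - z₀)⁻¹)
      refine h1.congr (ae_of_all _ fun t => ?_)
      simp only [slope_def_field, Pi.sub_apply]
      ring
    · refine (ae_restrict_iff' measurableSet_uIoc).2 (ae_of_all _ fun t ht => ?_)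
      exact ((hasDerivAt_iff_tendsto_slope.1 (hderiv z₀ (Metric.mem_ball_self hr0) _
        (IsSimpleLoop.mem_trace ht))).comp hlim).mul_const _
  · rw [norm_mul]
    refine mul_le_mul_of_nonneg_right ?_ (norm_nonneg _)
    have hw := IsSimpleLoop.mem_trace (γ := γ) ht
    refine Complex.norm_deriv_le_of_forall_mem_sphere_norm_le hr0 ?_ fun z hz => ?_
    · refine DifferentiableOn.diffContOnCl_ball (U := U) (hd _ hw) ((hsub' x hx).trans hsub)
    · exact hM (z, γ t) ⟨hsub' x hx (Metric.sphere_subset_closedBall hz), hw⟩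
  · exact (hderiv x hx _ (IsSimpleLoop.mem_trace ht)).mul_const _

end contourIntegral

/-! ### Cauchy integrals off the curve and winding numbers -/

section winding

variable {γ : ℝ → ℂ}

theorem sub_ne_zero_of_mem_trace {w z : ℂ} (hw : w ∈ trace γ) (hz : z ∉ trace γ) : w - z ≠ 0 :=
  sub_ne_zero.2 fun h => hz (h ▸ hw)

theorem continuousOn_div_sub {f : ℂ → ℂ} (hf : ContinuousOn f (trace γ)) {z : ℂ}
    (hz : z ∉ trace γ) : ContinuousOn (fun w => f w / (w - z)) (trace γ) :=
  hf.div (by fun_prop) fun _ hw => sub_ne_zero_of_mem_trace hw hz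

theorem differentiableOn_cauchyIntegral (hγ : IsSimpleLoop γ) {f : ℂ → ℂ}
    (hf : ContinuousOn f (trace γ)) :
    DifferentiableOn ℂ (fun z => contourIntegral (fun w => f w / (w - z)) γ) (trace γ)ᶜ := by
  refine differentiableOn_contourIntegral hγ hγ.isCompact_trace.isClosed.isOpen_compl
    (φ := fun z w => f w / (w - z)) ?_ fun w hw => ?_
  · refine ContinuousOn.div ?_ (by fun_prop) fun x hx => sub_ne_zero_of_mem_trace hx.2 hx.1
    exact hf.comp continuousOn_snd fun x hx => hx.2
  · exact DifferentiableOn.div (by fun_prop) (by fun_prop) fun z hz =>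
      sub_ne_zero_of_mem_trace hw hz

theorem tendsto_cauchyIntegral_cocompact (hγ : IsSimpleLoop γ) {f : ℂ → ℂ}
    (hf : ContinuousOn f (trace γ)) :
    Tendsto (fun z => contourIntegral (fun w => f w / (w - z)) γ) (cocompact ℂ) (𝓝 0) := by
  obtain ⟨M, hM⟩ := hγ.isCompact_trace.exists_bound_of_continuousOn hf
  obtain ⟨R, hR⟩ := hγ.isCompact_trace.exists_bound_of_continuousOn continuousOn_id
  have hnorm : Tendsto (fun z : ℂ => ‖z‖ - R) (cocompact ℂ) atTop :=
    tendsto_atTop_add_const_right _ (-R) tendsto_norm_cocompact_atTop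
  have hlim : Tendsto (fun z : ℂ => M / (‖z‖ - R) * curveLength γ) (cocompact ℂ) (𝓝 0) := by
    simpa using (hnorm.const_div_atTop M).mul_const (curveLength γ)
  refine squeeze_zero_norm' ?_ hlim
  filter_upwards [hnorm.eventually_gt_atTop 0] with z hz
  refine norm_contourIntegral_le hγ fun w hw => ?_
  rw [norm_div]
  have h1 := hM w hw
  have h2 : ‖w‖ ≤ R := hR w hw
  have h3 : ‖z‖ - ‖w‖ ≤ ‖w - z‖ := by rw [norm_sub_rev]; exact norm_sub_norm_le z w
  have h4 : 0 ≤ M := (norm_nonneg _).trans h1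
  gcongr
  linarith

theorem windingNumber_eq (p : ℂ) :
    windingNumber γ p =
      (2 * Real.pi * Complex.I)⁻¹ * contourIntegral (fun w => 1 / (w - p)) γ := by
  simp only [windingNumber, one_div]

theorem continuousOn_windingNumber (hγ : IsSimpleLoop γ) :
    ContinuousOn (windingNumber γ) (trace γ)ᶜ :=
  (continuousOn_const.mul (differentiableOn_cauchyIntegral hγ (f := fun _ => 1)
    continuousOn_const).continuousOn).congr fun p _ => windingNumber_eq p

theorem windingNumber_eq_zero {p : ℂ} (hp : p ∉ trace γ ∪ inside γ) : windingNumber γ p = 0 := by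
  by_contra h
  exact hp (Or.inr ⟨fun h' => hp (Or.inl h'), h⟩)

theorem windingNumber_eq_zero_or_one (hγ : IsSimpleLoop γ) {p : ℂ} (hp : p ∉ trace γ) :
    windingNumber γ p = 0 ∨ windingNumber γ p = 1 := by
  by_cases h : p ∈ inside γ
  · exact Or.inr (hγ.counterclockwise p h)
  · exact Or.inl (windingNumber_eq_zero (by simp [hp, h]))

theorem isOpen_inside (hγ : IsSimpleLoop γ) : IsOpen (inside γ) := by
  have := (continuousOn_windingNumber hγ).isOpen_inter_preimage
    hγ.isCompact_trace.isClosed.isOpen_compl (isOpen_compl_singleton (x := (0 : ℂ)))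
  exact this

/-- Off the curve the winding number is continuous with values 0 and 1 only, so the exterior is the
open set where it differs from 1. -/
theorem isOpen_compl_trace_union_inside (hγ : IsSimpleLoop γ) :
    IsOpen (trace γ ∪ inside γ)ᶜ := by
  have := (continuousOn_windingNumber hγ).isOpen_inter_preimage
    hγ.isCompact_trace.isClosed.isOpen_compl (isOpen_compl_singleton (x := (1 : ℂ)))
  convert this using 1
  ext p
  simp only [compl_union, mem_inter_iff, mem_compl_iff, mem_preimage, mem_singleton_iff]
  refine and_congr_right fun hp => ⟨fun h => ?_, fun h h' => h (hγ.counterclockwise p h')⟩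
  rw [windingNumber_eq_zero (by simp [hp, h])]
  exact zero_ne_one

theorem eventually_windingNumber_eq_zero (hγ : IsSimpleLoop γ) :
    ∀ᶠ p in cocompact ℂ, p ∉ trace γ ∪ inside γ := by
  have h1 : Tendsto (windingNumber γ) (cocompact ℂ) (𝓝 0) := by
    have := (tendsto_cauchyIntegral_cocompact hγ (f := fun _ => 1) continuousOn_const).const_mul
      (2 * Real.pi * Complex.I)⁻¹
    rw [mul_zero] at this
    exact this.congr fun p => (windingNumber_eq p).symm
  filter_upwards [h1.eventually_ne (zero_ne_one), hγ.isCompact_trace.compl_mem_cocompact]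
    with p hp hp' h
  rcases h with h | h
  · exact hp' h
  · exact hp (hγ.counterclockwise p h)

theorem isCompact_trace_union_inside (hγ : IsSimpleLoop γ) :
    IsCompact (trace γ ∪ inside γ) := by
  obtain ⟨t, ht, hts⟩ := mem_cocompact.1 (eventually_windingNumber_eq_zero hγ)
  refine ht.of_isClosed_subset (isOpen_compl_iff.1 (isOpen_compl_trace_union_inside hγ)) ?_
  intro p hp
  by_contra h
  exact hts h hp

end winding

/-! ### Cauchy's theorem for homologous loops -/

section dixon

theorem dslope_symm (f : ℂ → ℂ) (a b : ℂ) : dslope f a b = dslope f b a := by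
  rcases eq_or_ne a b with rfl | h
  · rfl
  · rw [dslope_of_ne _ h, dslope_of_ne _ h.symm, slope_comm]

/-- Near a diagonal point, strict differentiability controls the difference quotients and continuity
of the derivative controls the diagonal values. -/
theorem continuousOn_uncurry_dslope {f : ℂ → ℂ} {U : Set ℂ} (hU : IsOpen U)
    (hf : DifferentiableOn ℂ f U) : ContinuousOn (Function.uncurry (dslope f)) (U ×ˢ U) := by
  rintro ⟨z, w⟩ ⟨hz, hw⟩
  refine ContinuousAt.continuousWithinAt ?_
  have han : ∀ x ∈ U, AnalyticAt ℂ f x := fun x hx => hf.analyticAt (hU.mem_nhds hx)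
  rcases eq_or_ne z w with rfl | hne
  · rw [ContinuousAt, Metric.tendsto_nhds]
    intro ε hε
    have h1 := (han z hz).hasStrictDerivAt.isLittleO.def (half_pos hε)
    have h2 : ∀ᶠ p : ℂ × ℂ in 𝓝 (z, z), dist (deriv f p.1) (deriv f z) < ε :=
      ((han z hz).deriv.continuousAt.comp (x := (z, z)) continuousAt_fst).eventually
        (Metric.ball_mem_nhds _ hε)
    filter_upwards [h1, h2] with p hp1 hp2
    simp only [Function.uncurry, dslope_same]
    by_cases hp : p.1 = p.2
    · rw [← hp, dslope_same]
      exact hp2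
    · rw [dslope_of_ne _ (Ne.symm hp), slope_comm, slope_def_field, dist_eq_norm]
      have hpos : 0 < ‖p.1 - p.2‖ := norm_pos_iff.2 (sub_ne_zero.2 hp)
      have e : (f p.1 - f p.2) / (p.1 - p.2) - deriv f z =
          (f p.1 - f p.2 - (p.1 - p.2) * deriv f z) / (p.1 - p.2) := by
        field_simp [sub_ne_zero.2 hp]
      rw [e, norm_div, div_lt_iff₀ hpos]
      have : ‖f p.1 - f p.2 - (p.1 - p.2) * deriv f z‖ ≤ ε / 2 * ‖p.1 - p.2‖ := by
        simpa using hp1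
      nlinarith
  · have hev : ∀ᶠ p : ℂ × ℂ in 𝓝 (z, w),
        (f p.2 - f p.1) / (p.2 - p.1) = Function.uncurry (dslope f) p := by
      have : ∀ᶠ p : ℂ × ℂ in 𝓝 (z, w), p.1 ≠ p.2 :=
        (isOpen_ne_fun continuous_fst continuous_snd).mem_nhds hne
      filter_upwards [this] with p hp
      rw [Function.uncurry, dslope_of_ne _ hp.symm, slope_def_field]
    refine ContinuousAt.congr ?_ hev
    refine ContinuousAt.div ?_ (by fun_prop) (sub_ne_zero.2 hne.symm)
    exact ((han w hw).continuousAt.comp (x := (z, w)) continuousAt_snd).sub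
      ((han z hz).continuousAt.comp (x := (z, w)) continuousAt_fst)

variable {γ γ₁ γ₂ : ℝ → ℂ} {U : Set ℂ} {f : ℂ → ℂ}

theorem contourIntegral_dslope (hγ : IsSimpleLoop γ) (hf : ContinuousOn f (trace γ)) {z : ℂ}
    (hz : z ∉ trace γ) :
    contourIntegral (dslope f z) γ = contourIntegral (fun w => f w / (w - z)) γ -
      2 * Real.pi * Complex.I * windingNumber γ z * f z := by
  have h1 : (2 * Real.pi * Complex.I : ℂ) ≠ 0 := Complex.two_pi_I_ne_zero
  rw [windingNumber_eq, mul_inv_cancel_left₀ h1, ← contourIntegral_mul_const,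
    ← contourIntegral_sub hγ (continuousOn_div_sub hf hz) (h := fun w => 1 / (w - z) * f z)
      ((continuousOn_div_sub continuousOn_const hz).mul continuousOn_const)]
  refine contourIntegral_congr fun w hw => ?_
  have hne := sub_ne_zero_of_mem_trace hw hz
  rw [dslope_of_ne _ (sub_ne_zero.1 hne), slope_def_field]
  ring

theorem differentiableOn_contourIntegral_dslope (hγ : IsSimpleLoop γ) (hU : IsOpen U)
    (hf : DifferentiableOn ℂ f U) (ht : trace γ ⊆ U) :
    DifferentiableOn ℂ (fun z => contourIntegral (dslope f z) γ) U := by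
  refine differentiableOn_contourIntegral hγ hU
    ((continuousOn_uncurry_dslope hU hf).mono (prod_mono Subset.rfl ht)) fun w hw => ?_
  simp only [dslope_symm f _ w]
  exact (Complex.differentiableOn_dslope (hU.mem_nhds (ht hw))).2 hf

/-- The homology form of Cauchy's theorem for a difference of two loops (Dixon's argument). -/
theorem dixon (hγ₁ : IsSimpleLoop γ₁) (hγ₂ : IsSimpleLoop γ₂) (hU : IsOpen U)
    (hf : DifferentiableOn ℂ f U) (ht₁ : trace γ₁ ⊆ U) (ht₂ : trace γ₂ ⊆ U)
    (hw : ∀ p ∉ U, windingNumber γ₁ p = windingNumber γ₂ p) :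
    (∀ z ∈ U, contourIntegral (dslope f z) γ₁ = contourIntegral (dslope f z) γ₂) ∧
    (∀ z ∉ U, contourIntegral (fun w => f w / (w - z)) γ₁ =
      contourIntegral (fun w => f w / (w - z)) γ₂) := by
  classical
  have hc₁ := hf.continuousOn.mono ht₁
  have hc₂ := hf.continuousOn.mono ht₂
  set k : ℂ → ℂ := fun z => contourIntegral (fun w => f w / (w - z)) γ₁ -
    contourIntegral (fun w => f w / (w - z)) γ₂ with hk
  set l : ℂ → ℂ := fun z => contourIntegral (dslope f z) γ₁ -
    contourIntegral (dslope f z) γ₂ with hl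
  -- Dixon's function: `l` on U and the Cauchy integrals `k` elsewhere. They agree on U ∩ V, where
  -- the winding numbers coincide, and U ∪ V is the whole plane, so h is entire.
  set h : ℂ → ℂ := fun z => if z ∈ U then l z else k z with hh
  set T : Set ℂ := (trace γ₁ ∪ trace γ₂)ᶜ with hT
  have hTo : IsOpen T := (hγ₁.isCompact_trace.union hγ₂.isCompact_trace).isClosed.isOpen_compl
  have hT₁ : T ⊆ (trace γ₁)ᶜ := compl_subset_compl.2 subset_union_left
  have hT₂ : T ⊆ (trace γ₂)ᶜ := compl_subset_compl.2 subset_union_right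
  set V : Set ℂ := {z ∈ T | windingNumber γ₁ z = windingNumber γ₂ z} with hV
  have hVo : IsOpen V := by
    have h1 : ContinuousOn (fun z => ‖windingNumber γ₁ z - windingNumber γ₂ z‖) T :=
      (((continuousOn_windingNumber hγ₁).mono hT₁).sub
        ((continuousOn_windingNumber hγ₂).mono hT₂)).norm
    -- Both winding numbers are 0 or 1, so a difference of norm less than 1 vanishes.
    convert h1.isOpen_inter_preimage hTo (isOpen_Iio (a := (1 : ℝ))) using 1
    ext z
    simp only [hV, mem_ofPred_eq, mem_inter_iff, mem_preimage, mem_Iio]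
    refine and_congr_right fun hz => ?_
    rcases windingNumber_eq_zero_or_one hγ₁ (hT₁ hz) with e₁ | e₁ <;>
    rcases windingNumber_eq_zero_or_one hγ₂ (hT₂ hz) with e₂ | e₂ <;>
    simp [e₁, e₂]
  have hUV : ∀ z ∉ U, z ∈ V := fun z hz =>
    ⟨fun h' => hz (h'.elim (fun h => ht₁ h) fun h => ht₂ h), hw z hz⟩
  have hhV : EqOn h k V := by
    intro z hz
    simp only [hh]
    split_ifs with hzU
    · simp only [hl, hk]
      rw [contourIntegral_dslope hγ₁ hc₁ (hT₁ hz.1), contourIntegral_dslope hγ₂ hc₂ (hT₂ hz.1),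
        hz.2]
      ring
    · rfl
  have hhU : EqOn h l U := fun z hz => if_pos hz
  have hdiff : Differentiable ℂ h := by
    intro z
    by_cases hz : z ∈ U
    · have : DifferentiableOn ℂ l U :=
        (differentiableOn_contourIntegral_dslope hγ₁ hU hf ht₁).sub
          (differentiableOn_contourIntegral_dslope hγ₂ hU hf ht₂)
      exact (this.congr hhU).differentiableAt (hU.mem_nhds hz)
    · have : DifferentiableOn ℂ k V :=
        ((differentiableOn_cauchyIntegral hγ₁ hc₁).mono fun z hz => hT₁ hz.1).sub
          ((differentiableOn_cauchyIntegral hγ₂ hc₂).mono fun z hz => hT₂ hz.1)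
      exact (this.congr hhV).differentiableAt (hVo.mem_nhds (hUV z hz))
  have hlim : Tendsto h (cocompact ℂ) (𝓝 0) := by
    have hklim : Tendsto k (cocompact ℂ) (𝓝 0) := by
      simpa using (tendsto_cauchyIntegral_cocompact hγ₁ hc₁).sub
        (tendsto_cauchyIntegral_cocompact hγ₂ hc₂)
    refine hklim.congr' ?_
    filter_upwards [eventually_windingNumber_eq_zero hγ₁, eventually_windingNumber_eq_zero hγ₂]
      with z h1 h2
    refine (hhV ⟨?_, ?_⟩).symm
    · exact fun h' => h'.elim (fun h => h1 (Or.inl h)) fun h => h2 (Or.inl h)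
    · rw [windingNumber_eq_zero h1, windingNumber_eq_zero h2]
  -- Liouville's theorem.
  have hzero : ∀ z, h z = 0 := fun z => hdiff.apply_eq_of_tendsto_cocompact z hlim
  exact ⟨fun z hz => sub_eq_zero.1 ((hhU hz).symm.trans (hzero z)),
    fun z hz => sub_eq_zero.1 ((hhV (hUV z hz)).symm.trans (hzero z))⟩

/-- Cauchy's theorem for homologous loops in a proper open subset of the plane. -/
theorem contourIntegral_eq_of_homologous (hγ₁ : IsSimpleLoop γ₁) (hγ₂ : IsSimpleLoop γ₂)
    (hU : IsOpen U) (hU' : U ≠ univ) (hf : DifferentiableOn ℂ f U) (ht₁ : trace γ₁ ⊆ U)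
    (ht₂ : trace γ₂ ⊆ U) (hw : ∀ p ∉ U, windingNumber γ₁ p = windingNumber γ₂ p) :
    contourIntegral f γ₁ = contourIntegral f γ₂ := by
  obtain ⟨z, hz⟩ := (ne_univ_iff_exists_notMem U).1 hU'
  -- For z outside U the factor w − z cancels the Cauchy kernel and leaves the integral of f.
  have h := (dixon hγ₁ hγ₂ hU (f := fun w => f w * (w - z)) (hf.mul (by fun_prop)) ht₁ ht₂ hw).2
    z hz
  have e : ∀ γ : ℝ → ℂ, trace γ ⊆ U →
      contourIntegral (fun w => f w * (w - z) / (w - z)) γ = contourIntegral f γ :=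
    fun γ ht => contourIntegral_congr fun w hw =>
      mul_div_cancel_right₀ _ (sub_ne_zero_of_mem_trace hw fun h => hz (ht h))
  rwa [e γ₁ ht₁, e γ₂ ht₂] at h

/-- Cauchy's integral formula for a difference of two homologous loops. -/
theorem cauchyIntegral_sub_of_homologous (hγ₁ : IsSimpleLoop γ₁) (hγ₂ : IsSimpleLoop γ₂)
    (hU : IsOpen U) (hf : DifferentiableOn ℂ f U) (ht₁ : trace γ₁ ⊆ U)
    (ht₂ : trace γ₂ ⊆ U) (hw : ∀ p ∉ U, windingNumber γ₁ p = windingNumber γ₂ p) {z : ℂ}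
    (hz : z ∈ U) (hz₁ : z ∉ trace γ₁) (hz₂ : z ∉ trace γ₂) :
    contourIntegral (fun w => f w / (w - z)) γ₁ - contourIntegral (fun w => f w / (w - z)) γ₂ =
      2 * Real.pi * Complex.I * (windingNumber γ₁ z - windingNumber γ₂ z) * f z := by
  have h := (dixon hγ₁ hγ₂ hU hf ht₁ ht₂ hw).1 z hz
  rw [contourIntegral_dslope hγ₁ (hf.continuousOn.mono ht₁) hz₁,
    contourIntegral_dslope hγ₂ (hf.continuousOn.mono ht₂) hz₂] at h
  linear_combination h

end dixon

/-! ### Homology and Cauchy's formula for admissible contours -/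

namespace AdmissibleContours

variable {Ω Ω₀ P Q : Set ℂ} {Γ₁ Γ₂ C₁ C₂ : ℝ → ℂ} {p z z₂ : ℂ}

theorem mono (h : AdmissibleContours Ω Ω₀ P Γ₁ Γ₂) (hQ : Q ⊆ P) :
    AdmissibleContours Ω Ω₀ Q Γ₁ Γ₂ :=
  { h with points₁ := hQ.trans h.points₁, points₂ := h.points₂.mono_left hQ }

theorem notMem_outer (h : AdmissibleContours Ω Ω₀ P Γ₁ Γ₂) (hp : p ∉ Ω) :
    p ∉ trace Γ₁ ∪ inside Γ₁ := by
  rintro (h' | h')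
  · exact hp (h.trace₁ h').1
  · exact hp (h.inside₁ h')

theorem notMem_inner (h : AdmissibleContours Ω Ω₀ P Γ₁ Γ₂) (hp : p ∉ Ω) :
    p ∉ trace Γ₂ ∪ inside Γ₂ := fun h' => hp (h.inside₁ (h.encircle₁ h'))

theorem core_subset_inside₁ (h : AdmissibleContours Ω Ω₀ P Γ₁ Γ₂) : Ω₀ ⊆ inside Γ₁ :=
  fun _ hp => h.encircle₁ (Or.inr (h.encircle₂ hp))

theorem notMem_trace₁ (h : AdmissibleContours Ω Ω₀ P Γ₁ Γ₂) (hz : z ∈ P) : z ∉ trace Γ₁ :=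
  (h.points₁ hz).1

theorem notMem_outside₂ (h : AdmissibleContours Ω Ω₀ P Γ₁ Γ₂) (hz : z ∈ P) :
    z ∉ trace Γ₂ ∪ inside Γ₂ := Set.disjoint_left.1 h.points₂ hz

theorem windingNumber_eq (h : AdmissibleContours Ω Ω₀ P Γ₁ Γ₂) (hp : p ∉ Ω \ Ω₀) :
    windingNumber Γ₁ p = windingNumber Γ₂ p := by
  by_cases hpΩ : p ∈ Ω
  · have hp0 : p ∈ Ω₀ := by
      by_contra h'
      exact hp ⟨hpΩ, h'⟩
    rw [h.loop₁.counterclockwise p (h.core_subset_inside₁ hp0),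
      h.loop₂.counterclockwise p (h.encircle₂ hp0)]
  · rw [windingNumber_eq_zero (h.notMem_outer hpΩ), windingNumber_eq_zero (h.notMem_inner hpΩ)]

/-- The coefficient integrands have poles at z₂, hence the puncture. Outer loops of admissible pairs
all wind once around z₂ and inner loops do not wind around it, so like loops remain homologous. -/
theorem contourIntegral_eq (hΩ : IsOpen Ω) (hΩ₀ : IsClosed Ω₀)
    (h : AdmissibleContours Ω Ω₀ {z₂} Γ₁ Γ₂) (h' : AdmissibleContours Ω Ω₀ {z₂} C₁ C₂)
    {g : ℂ → ℂ} (hg : DifferentiableOn ℂ g ((Ω \ Ω₀) \ {z₂})) :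
    contourIntegral g Γ₁ = contourIntegral g C₁ ∧
      contourIntegral g Γ₂ = contourIntegral g C₂ := by
  have hU : IsOpen ((Ω \ Ω₀) \ {z₂}) := (hΩ.sdiff hΩ₀).sdiff isClosed_singleton
  have hU' : (Ω \ Ω₀) \ {z₂} ≠ univ := (ne_univ_iff_exists_notMem _).2 ⟨z₂, by simp⟩
  have hs₁ : ∀ {G₁ G₂ : ℝ → ℂ}, AdmissibleContours Ω Ω₀ {z₂} G₁ G₂ →
      trace G₁ ⊆ (Ω \ Ω₀) \ {z₂} := fun hG w hw =>
    ⟨hG.trace₁ hw, fun e => hG.notMem_trace₁ (mem_singleton z₂) (e ▸ hw)⟩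
  have hs₂ : ∀ {G₁ G₂ : ℝ → ℂ}, AdmissibleContours Ω Ω₀ {z₂} G₁ G₂ →
      trace G₂ ⊆ (Ω \ Ω₀) \ {z₂} := fun hG w hw =>
    ⟨hG.trace₂ hw, fun e => hG.notMem_outside₂ (mem_singleton z₂) (e ▸ Or.inl hw)⟩
  have hcases : ∀ p ∉ (Ω \ Ω₀) \ {z₂}, p ∉ Ω ∨ p ∈ Ω₀ ∨ p = z₂ := by
    intro p hp
    simp only [Set.mem_sdiff, mem_singleton_iff, not_and, not_not] at hp
    tauto
  constructor
  · refine contourIntegral_eq_of_homologous h.loop₁ h'.loop₁ hU hU' hg (hs₁ h) (hs₁ h')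
      fun p hp => ?_
    rcases hcases p hp with hp | hp | rfl
    · rw [windingNumber_eq_zero (h.notMem_outer hp), windingNumber_eq_zero (h'.notMem_outer hp)]
    · rw [h.loop₁.counterclockwise p (h.core_subset_inside₁ hp),
        h'.loop₁.counterclockwise p (h'.core_subset_inside₁ hp)]
    · rw [h.loop₁.counterclockwise p (h.points₁ rfl),
        h'.loop₁.counterclockwise p (h'.points₁ rfl)]
  · refine contourIntegral_eq_of_homologous h.loop₂ h'.loop₂ hU hU' hg (hs₂ h) (hs₂ h')
      fun p hp => ?_
    rcases hcases p hp with hp | hp | rfl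
    · rw [windingNumber_eq_zero (h.notMem_inner hp), windingNumber_eq_zero (h'.notMem_inner hp)]
    · rw [h.loop₂.counterclockwise p (h.encircle₂ hp),
        h'.loop₂.counterclockwise p (h'.encircle₂ hp)]
    · rw [windingNumber_eq_zero (h.notMem_outside₂ rfl),
        windingNumber_eq_zero (h'.notMem_outside₂ rfl)]

variable {f : ℂ → ℂ} {z₁ : ℂ}

theorem coeff_eq (hΩ : IsOpen Ω) (hΩ₀ : IsClosed Ω₀) (hf : DifferentiableOn ℂ f (Ω \ Ω₀))
    (hz₁ : z₁ ∈ Ω₀) (h : AdmissibleContours Ω Ω₀ {z₂} Γ₁ Γ₂)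
    (h' : AdmissibleContours Ω Ω₀ {z₂} C₁ C₂) (n : ℕ) :
    dCoeff f Γ₁ z₁ z₂ n = dCoeff f C₁ z₁ z₂ n ∧
      dCoeff f Γ₁ z₂ z₁ n = dCoeff f C₁ z₂ z₁ n ∧
      eCoeff f Γ₂ z₁ z₂ n = eCoeff f C₂ z₁ z₂ n := by
  have hf' : DifferentiableOn ℂ f ((Ω \ Ω₀) \ {z₂}) := hf.mono sdiff_subset
  have hne₁ : ∀ w ∈ (Ω \ Ω₀) \ {z₂}, w - z₁ ≠ 0 := fun w hw =>
    sub_ne_zero.2 fun e => hw.1.2 (e ▸ hz₁)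
  have hne₂ : ∀ w ∈ (Ω \ Ω₀) \ {z₂}, w - z₂ ≠ 0 := fun w hw => sub_ne_zero.2 hw.2
  refine ⟨?_, ?_, ?_⟩
  · simp only [dCoeff]
    rw [(contourIntegral_eq hΩ hΩ₀ h h'
      (g := fun w => f w / ((w - z₁) ^ n * (w - z₂) ^ (n + 1)))
      (hf'.div (by fun_prop) fun w hw =>
        mul_ne_zero (pow_ne_zero _ (hne₁ w hw)) (pow_ne_zero _ (hne₂ w hw)))).1]
  · simp only [dCoeff]
    rw [(contourIntegral_eq hΩ hΩ₀ h h'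
      (g := fun w => f w / ((w - z₂) ^ n * (w - z₁) ^ (n + 1)))
      (hf'.div (by fun_prop) fun w hw =>
        mul_ne_zero (pow_ne_zero _ (hne₂ w hw)) (pow_ne_zero _ (hne₁ w hw)))).1]
  · simp only [eCoeff]
    rw [(contourIntegral_eq hΩ hΩ₀ h h'
      (g := fun w => (w - z₁) ^ n / (w - z₂) ^ (n + 1) * f w)
      (DifferentiableOn.mul (DifferentiableOn.div
        (by fun_prop) (by fun_prop) fun w hw => pow_ne_zero _ (hne₂ w hw)) hf')).2]

/-- Cauchy's integral formula for an admissible pair of contours. -/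
theorem cauchy_formula (hΩ : IsOpen Ω) (hΩ₀ : IsClosed Ω₀) (hf : DifferentiableOn ℂ f (Ω \ Ω₀))
    (h : AdmissibleContours Ω Ω₀ P Γ₁ Γ₂) (hz : z ∈ Ω \ Ω₀) (hz₁ : z ∈ inside Γ₁)
    (hz₂ : z ∉ trace Γ₂ ∪ inside Γ₂) :
    f z = 1 / (2 * Real.pi * Complex.I) * contourIntegral (fun w => f w / (w - z)) Γ₁ -
      1 / (2 * Real.pi * Complex.I) * contourIntegral (fun w => f w / (w - z)) Γ₂ := by
  have hπ : (2 * Real.pi * Complex.I : ℂ) ≠ 0 := Complex.two_pi_I_ne_zero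
  have key := cauchyIntegral_sub_of_homologous h.loop₁ h.loop₂ (hΩ.sdiff hΩ₀) hf h.trace₁ h.trace₂
    (fun p hp => h.windingNumber_eq hp) hz hz₁.1 fun h' => hz₂ (Or.inl h')
  rw [h.loop₁.counterclockwise z hz₁, windingNumber_eq_zero hz₂, sub_zero, mul_one] at key
  rw [← mul_sub, key]
  field_simp

end AdmissibleContours

/-! ### The finite expansion with remainder -/

section expansion

/-- With q = (z − z₁)(z − z₂)/((w − z₁)(w − z₂)), one has (1 − q)/(w − z) = (w + z − z₁ − z₂)/((w −
z₁)(w − z₂)). The partial fractions of the right side, times the powers of q, are the summands. -/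
theorem two_point_taylor_kernel {z₁ z₂ z w : ℂ} (h : z₂ - z₁ ≠ 0) (h₁ : w - z₁ ≠ 0)
    (h₂ : w - z₂ ≠ 0) (hz : w - z ≠ 0) (N : ℕ) :
    1 / (w - z) = ∑ n ∈ Finset.range N,
      (1 / ((w - z₁) ^ n * (w - z₂) ^ (n + 1)) * (z - z₁) / (z₂ - z₁) -
        1 / ((w - z₂) ^ n * (w - z₁) ^ (n + 1)) * (z - z₂) / (z₂ - z₁)) *
        ((z - z₁) ^ n * (z - z₂) ^ n) +
      1 / ((w - z₁) ^ N * (w - z₂) ^ N * (w - z)) * ((z - z₁) ^ N * (z - z₂) ^ N) := by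
  induction N with
  | zero => simp
  | succ N ih =>
    rw [Finset.sum_range_succ, ih, add_assoc]
    congr 1
    simp only [pow_succ]
    field_simp
    ring

/-- A finite geometric sum: for q = (w − z₁)(z − z₂)/((w − z₂)(z − z₁)), 1 − q = (w − z)(z₂ −
z₁)/((w − z₂)(z − z₁)). -/
theorem quotient_laurent_kernel {z₁ z₂ z w : ℂ} (h₂ : w - z₂ ≠ 0) (hz₁ : z - z₁ ≠ 0)
    (hz : w - z ≠ 0) (N : ℕ) :
    1 / (w - z) = (w - z₁) ^ N / ((w - z₂) ^ N * (w - z)) * ((z - z₂) ^ N / (z - z₁) ^ N) -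
      ∑ n ∈ Finset.range N, (z₁ - z₂) * ((w - z₁) ^ n / (w - z₂) ^ (n + 1)) *
        ((z - z₂) ^ n / (z - z₁) ^ (n + 1)) := by
  induction N with
  | zero => simp
  | succ N ih =>
    rw [Finset.sum_range_succ, ih, sub_add_eq_sub_sub_swap]
    congr 1
    simp only [pow_succ]
    field_simp
    ring

variable {f : ℂ → ℂ} {γ : ℝ → ℂ} {z₁ z₂ z : ℂ}

theorem cauchyIntegral_eq_sum_taylorTerm (hγ : IsSimpleLoop γ) (hf : ContinuousOn f (trace γ))
    (h : z₁ ≠ z₂) (h₁ : z₁ ∉ trace γ) (h₂ : z₂ ∉ trace γ) (hz : z ∉ trace γ) (N : ℕ) :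
    1 / (2 * Real.pi * Complex.I) * contourIntegral (fun w => f w / (w - z)) γ =
      ∑ n ∈ Finset.range N, taylorTerm f γ z₁ z₂ z n +
      1 / (2 * Real.pi * Complex.I) *
        contourIntegral (fun w => f w / ((w - z₁) ^ N * (w - z₂) ^ N * (w - z))) γ *
        ((z - z₁) ^ N * (z - z₂) ^ N) := by
  have hne₁ : ∀ w ∈ trace γ, w - z₁ ≠ 0 := fun w hw => sub_ne_zero_of_mem_trace hw h₁
  have hne₂ : ∀ w ∈ trace γ, w - z₂ ≠ 0 := fun w hw => sub_ne_zero_of_mem_trace hw h₂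
  have hne : ∀ w ∈ trace γ, w - z ≠ 0 := fun w hw => sub_ne_zero_of_mem_trace hw hz
  have hsub : z₂ - z₁ ≠ 0 := sub_ne_zero.2 h.symm
  have hsub' : z₁ - z₂ ≠ 0 := sub_ne_zero.2 h
  have hπ : (2 * Real.pi * Complex.I : ℂ) ≠ 0 := Complex.two_pi_I_ne_zero
  have c₁ : ∀ n, ContinuousOn (fun w => f w / ((w - z₁) ^ n * (w - z₂) ^ (n + 1))) (trace γ) :=
    fun n => hf.div (by fun_prop) fun w hw =>
      mul_ne_zero (pow_ne_zero _ (hne₁ w hw)) (pow_ne_zero _ (hne₂ w hw))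
  have c₂ : ∀ n, ContinuousOn (fun w => f w / ((w - z₂) ^ n * (w - z₁) ^ (n + 1))) (trace γ) :=
    fun n => hf.div (by fun_prop) fun w hw =>
      mul_ne_zero (pow_ne_zero _ (hne₂ w hw)) (pow_ne_zero _ (hne₁ w hw))
  have c₃ : ContinuousOn (fun w => f w / ((w - z₁) ^ N * (w - z₂) ^ N * (w - z))) (trace γ) :=
    hf.div (by fun_prop) fun w hw => mul_ne_zero
      (mul_ne_zero (pow_ne_zero _ (hne₁ w hw)) (pow_ne_zero _ (hne₂ w hw))) (hne w hw)
  set A : ℕ → ℂ := fun n => (z - z₁) / (z₂ - z₁) * ((z - z₁) ^ n * (z - z₂) ^ n) with hA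
  set B : ℕ → ℂ := fun n => (z - z₂) / (z₂ - z₁) * ((z - z₁) ^ n * (z - z₂) ^ n) with hB
  have key : contourIntegral (fun w => f w / (w - z)) γ =
      contourIntegral (fun w => ∑ n ∈ Finset.range N,
        (f w / ((w - z₁) ^ n * (w - z₂) ^ (n + 1)) * A n -
          f w / ((w - z₂) ^ n * (w - z₁) ^ (n + 1)) * B n) +
        f w / ((w - z₁) ^ N * (w - z₂) ^ N * (w - z)) * ((z - z₁) ^ N * (z - z₂) ^ N)) γ := by
    refine contourIntegral_congr fun w hw => ?_
    have := two_point_taylor_kernel hsub (hne₁ w hw) (hne₂ w hw) (hne w hw) N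
    rw [div_eq_mul_one_div, this, mul_add, Finset.mul_sum]
    congr 1
    · exact Finset.sum_congr rfl fun n _ => by simp only [hA, hB]; ring
    · ring
  have cs : ∀ n ∈ Finset.range N, ContinuousOn (fun w =>
      f w / ((w - z₁) ^ n * (w - z₂) ^ (n + 1)) * A n -
          f w / ((w - z₂) ^ n * (w - z₁) ^ (n + 1)) * B n) (trace γ) := fun n _ =>
    ((c₁ n).mul continuousOn_const).sub ((c₂ n).mul continuousOn_const)
  rw [key, contourIntegral_add hγ (continuousOn_finsetSum _ cs)
      (h := fun w => f w / ((w - z₁) ^ N * (w - z₂) ^ N * (w - z)) *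
        ((z - z₁) ^ N * (z - z₂) ^ N)) (c₃.mul continuousOn_const),
    contourIntegral_sum hγ _ cs, contourIntegral_mul_const, mul_add, Finset.mul_sum]
  congr 1
  · refine Finset.sum_congr rfl fun n _ => ?_
    rw [contourIntegral_sub hγ
        (g := fun w => f w / ((w - z₁) ^ n * (w - z₂) ^ (n + 1)) * A n)
        (h := fun w => f w / ((w - z₂) ^ n * (w - z₁) ^ (n + 1)) * B n)
        ((c₁ n).mul continuousOn_const) ((c₂ n).mul continuousOn_const),
      contourIntegral_mul_const, contourIntegral_mul_const]
    simp only [taylorTerm, dCoeff, hA, hB]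
    have e : (2 * Real.pi * Complex.I * (z₁ - z₂) : ℂ) = -(2 * Real.pi * Complex.I * (z₂ - z₁)) := by
      ring
    rw [e]
    field_simp
    ring
  · ring

theorem cauchyIntegral_eq_sum_laurentTerm (hγ : IsSimpleLoop γ) (hf : ContinuousOn f (trace γ))
    (hzz : z ≠ z₁) (h₂ : z₂ ∉ trace γ) (hz : z ∉ trace γ) (N : ℕ) :
    1 / (2 * Real.pi * Complex.I) * contourIntegral (fun w => f w / (w - z)) γ =
      1 / (2 * Real.pi * Complex.I) *
        contourIntegral (fun w => (w - z₁) ^ N * f w / ((w - z₂) ^ N * (w - z))) γ *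
        ((z - z₂) ^ N / (z - z₁) ^ N) -
      ∑ n ∈ Finset.range N, laurentTerm f γ z₁ z₂ z n := by
  have hne₂ : ∀ w ∈ trace γ, w - z₂ ≠ 0 := fun w hw => sub_ne_zero_of_mem_trace hw h₂
  have hne : ∀ w ∈ trace γ, w - z ≠ 0 := fun w hw => sub_ne_zero_of_mem_trace hw hz
  have hsub : z - z₁ ≠ 0 := sub_ne_zero.2 hzz
  have c₁ : ∀ n, ContinuousOn (fun w => (w - z₁) ^ n / (w - z₂) ^ (n + 1) * f w) (trace γ) :=
    fun n => ContinuousOn.mul (ContinuousOn.div (by fun_prop) (by fun_prop) fun w hw =>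
      pow_ne_zero _ (hne₂ w hw)) hf
  have c₂ : ContinuousOn (fun w => (w - z₁) ^ N * f w / ((w - z₂) ^ N * (w - z))) (trace γ) :=
    ContinuousOn.div (ContinuousOn.mul (by fun_prop) hf) (by fun_prop) fun w hw =>
      mul_ne_zero (pow_ne_zero _ (hne₂ w hw)) (hne w hw)
  set A : ℕ → ℂ := fun n => (z₁ - z₂) * ((z - z₂) ^ n / (z - z₁) ^ (n + 1)) with hA
  have key : contourIntegral (fun w => f w / (w - z)) γ =
      contourIntegral (fun w => (w - z₁) ^ N * f w / ((w - z₂) ^ N * (w - z)) *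
        ((z - z₂) ^ N / (z - z₁) ^ N) -
        ∑ n ∈ Finset.range N, (w - z₁) ^ n / (w - z₂) ^ (n + 1) * f w * A n) γ := by
    refine contourIntegral_congr fun w hw => ?_
    have := quotient_laurent_kernel (hne₂ w hw) hsub (hne w hw) N
    rw [div_eq_mul_one_div, this, mul_sub, Finset.mul_sum]
    congr 1
    · ring
    · exact Finset.sum_congr rfl fun n _ => by simp only [hA]; ring
  have cs : ∀ n ∈ Finset.range N, ContinuousOn (fun w =>
      (w - z₁) ^ n / (w - z₂) ^ (n + 1) * f w * A n) (trace γ) := fun n _ =>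
    (c₁ n).mul continuousOn_const
  rw [key, contourIntegral_sub hγ
      (g := fun w => (w - z₁) ^ N * f w / ((w - z₂) ^ N * (w - z)) *
        ((z - z₂) ^ N / (z - z₁) ^ N)) (c₂.mul continuousOn_const) (continuousOn_finsetSum _ cs),
    contourIntegral_sum hγ _ cs, contourIntegral_mul_const, mul_sub, Finset.mul_sum]
  congr 1
  · ring
  · refine Finset.sum_congr rfl fun n _ => ?_
    rw [contourIntegral_mul_const]
    simp only [laurentTerm, eCoeff, hA]
    ring

theorem AdmissibleContours.expansion {Ω Ω₀ : Set ℂ} {Γ₁ Γ₂ C₁ C₂ : ℝ → ℂ} (hΩ : IsOpen Ω)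
    (hΩ₀ : IsClosed Ω₀) (hf : DifferentiableOn ℂ f (Ω \ Ω₀)) (hz₁ : z₁ ∈ Ω₀) (hz : z ∈ Ω \ Ω₀)
    (hz₂ : z₂ ∈ Ω \ Ω₀)
    (h : AdmissibleContours Ω Ω₀ {z, z₂} Γ₁ Γ₂) (h' : AdmissibleContours Ω Ω₀ {z₂} C₁ C₂)
    (N : ℕ) :
    f z = ∑ n ∈ Finset.range N, taylorTerm f C₁ z₁ z₂ z n +
        ∑ n ∈ Finset.range N, laurentTerm f C₂ z₁ z₂ z n + remainder f Γ₁ Γ₂ z₁ z₂ z N := by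
  have hcoeff := coeff_eq hΩ hΩ₀ hf hz₁ (h.mono (by simp)) h'
  have e₁ : ∀ n, taylorTerm f C₁ z₁ z₂ z n = taylorTerm f Γ₁ z₁ z₂ z n := fun n => by
    simp only [taylorTerm, (hcoeff n).1, (hcoeff n).2.1]
  have e₂ : ∀ n, laurentTerm f C₂ z₁ z₂ z n = laurentTerm f Γ₂ z₁ z₂ z n := fun n => by
    simp only [laurentTerm, (hcoeff n).2.2]
  have hz₂₁ : z₁ ≠ z₂ := fun e => hz₂.2 (e ▸ hz₁)
  simp only [e₁, e₂]
  rw [h.cauchy_formula hΩ hΩ₀ hf hz (h.points₁ (by simp)) (h.notMem_outside₂ (by simp)),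
    cauchyIntegral_eq_sum_taylorTerm h.loop₁ (hf.continuousOn.mono h.trace₁) hz₂₁
      (h.core_subset_inside₁ hz₁).1 (h.notMem_trace₁ (by simp)) (h.notMem_trace₁ (by simp)) N,
    cauchyIntegral_eq_sum_laurentTerm (z₁ := z₁) (z := z) h.loop₂ (hf.continuousOn.mono h.trace₂)
      (fun e => hz.2 (e ▸ hz₁)) (fun h' => h.notMem_outside₂ (z := z₂) (by simp) (Or.inl h'))
      (fun h' => h.notMem_outside₂ (z := z) (by simp) (Or.inl h')) N]
  simp only [remainder]
  ring

end expansion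

/-- Splitting of `f` into a part that is holomorphic on `Ω` and one that is holomorphic off `Ω₀`. -/
theorem AdmissibleContours.exists_splitting {Ω Ω₀ P : Set ℂ} {f : ℂ → ℂ} {C₁ C₂ : ℝ → ℂ}
    (hΩ : IsOpen Ω) (hΩ₀ : IsClosed Ω₀) (hf : DifferentiableOn ℂ f (Ω \ Ω₀))
    (h : AdmissibleContours Ω Ω₀ P C₁ C₂) :
    ∃ F₁ F₂ : ℂ → ℂ, DifferentiableOn ℂ F₁ Ω ∧ DifferentiableOn ℂ F₂ Ω₀ᶜ ∧
      (∀ z ∈ Ω \ Ω₀, f z = F₁ z + F₂ z) ∧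
      (∀ z ∈ inside C₁, F₁ z =
        1 / (2 * Real.pi * Complex.I) * contourIntegral (fun w => f w / (w - z)) C₁) ∧
      (∀ z ∉ trace C₂ ∪ inside C₂, F₂ z =
        -(1 / (2 * Real.pi * Complex.I) * contourIntegral (fun w => f w / (w - z)) C₂)) := by
  classical
  set g₁ : ℂ → ℂ := fun z =>
    1 / (2 * Real.pi * Complex.I) * contourIntegral (fun w => f w / (w - z)) C₁ with hg₁
  set g₂ : ℂ → ℂ := fun z =>
    -(1 / (2 * Real.pi * Complex.I) * contourIntegral (fun w => f w / (w - z)) C₂) with hg₂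
  have hU : IsOpen (Ω \ Ω₀) := hΩ.sdiff hΩ₀
  have hI : IsOpen (inside C₁) := isOpen_inside h.loop₁
  have hO : IsOpen (trace C₂ ∪ inside C₂)ᶜ := isOpen_compl_trace_union_inside h.loop₂
  have hd₁ : DifferentiableOn ℂ g₁ (inside C₁) :=
    ((differentiableOn_cauchyIntegral h.loop₁ (hf.continuousOn.mono h.trace₁)).const_mul _).mono
      fun z hz => hz.1
  have hd₂ : DifferentiableOn ℂ g₂ (trace C₂ ∪ inside C₂)ᶜ :=
    ((differentiableOn_cauchyIntegral h.loop₂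
      (hf.continuousOn.mono h.trace₂)).const_mul _).neg.mono fun z hz h' => hz (Or.inl h')
  have hsum : ∀ z ∈ Ω \ Ω₀, z ∈ inside C₁ → z ∉ trace C₂ ∪ inside C₂ → f z = g₁ z + g₂ z := by
    intro z hz h1 h2
    rw [h.cauchy_formula hΩ hΩ₀ hf hz h1 h2]
    simp only [hg₁, hg₂]
    ring
  -- The Cauchy integrals g₁ and g₂ are continued across C₁ and C₂ by f − g₂ and f − g₁; Cauchy's
  -- formula makes the definitions agree on the overlaps.
  refine ⟨fun z => if z ∈ inside C₁ then g₁ z else f z - g₂ z,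
    fun z => if z ∉ trace C₂ ∪ inside C₂ then g₂ z else f z - g₁ z, ?_, ?_, ?_,
    fun z hz => if_pos hz, fun z hz => if_pos hz⟩
  · intro z hz
    refine DifferentiableAt.differentiableWithinAt ?_
    by_cases hzI : z ∈ inside C₁
    · exact (hd₁.congr fun x hx => if_pos hx).differentiableAt (hI.mem_nhds hzI)
    · have hzO : z ∈ (Ω \ Ω₀) ∩ (trace C₂ ∪ inside C₂)ᶜ :=
        ⟨⟨hz, fun h' => hzI (h.core_subset_inside₁ h')⟩, fun h' => hzI (h.encircle₁ h')⟩
      have hd : DifferentiableOn ℂ (fun x => f x - g₂ x) ((Ω \ Ω₀) ∩ (trace C₂ ∪ inside C₂)ᶜ) :=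
        (hf.mono inter_subset_left).sub (hd₂.mono inter_subset_right)
      refine (hd.congr fun x hx => ?_).differentiableAt ((hU.inter hO).mem_nhds hzO)
      split_ifs with hxI
      · rw [hsum x hx.1 hxI hx.2, add_sub_cancel_right]
      · rfl
  · intro z hz
    refine DifferentiableAt.differentiableWithinAt ?_
    by_cases hzO : z ∉ trace C₂ ∪ inside C₂
    · exact (hd₂.congr fun x hx => if_pos hx).differentiableAt (hO.mem_nhds hzO)
    · have hzI : z ∈ inside C₁ := h.encircle₁ (not_not.1 hzO)
      have hzI' : z ∈ (Ω \ Ω₀) ∩ inside C₁ := ⟨⟨h.inside₁ hzI, hz⟩, hzI⟩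
      have hd : DifferentiableOn ℂ (fun x => f x - g₁ x) ((Ω \ Ω₀) ∩ inside C₁) :=
        (hf.mono inter_subset_left).sub (hd₁.mono inter_subset_right)
      refine (hd.congr fun x hx => ?_).differentiableAt ((hU.inter hI).mem_nhds hzI')
      split_ifs with hxO
      · rfl
      · rw [hsum x hx.1 hx.2 hxO, add_sub_cancel_left]
  · intro z hz
    by_cases h1 : z ∈ inside C₁
    · by_cases h2 : z ∈ trace C₂ ∪ inside C₂
      · simp only [if_pos h1, not_not.2 h2, if_false]
        ring
      · simp only [if_pos h1, if_pos h2]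
        exact hsum z hz h1 h2
    · have h2 : z ∉ trace C₂ ∪ inside C₂ := fun h' => h1 (h.encircle₁ h')
      simp only [if_neg h1, if_pos h2]
      ring

/-! ### Even and odd parts as functions of the square -/

section evenOdd

/-- Take A(v) = E(√v); evenness makes the choice of root irrelevant, and v = 0 is a removable
singularity because the root is continuous there. -/
theorem exists_comp_sq_of_even {V : Set ℂ} (hV : IsOpen V) {E : ℂ → ℂ}
    (hE : DifferentiableOn ℂ E ((fun ζ => ζ ^ 2) ⁻¹' V))
    (heven : ∀ ζ, ζ ^ 2 ∈ V → E (-ζ) = E ζ) :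
    ∃ A : ℂ → ℂ, DifferentiableOn ℂ A V ∧ ∀ ζ, ζ ^ 2 ∈ V → E ζ = A (ζ ^ 2) := by
  set s : ℂ → ℂ := fun v => v ^ (((2 : ℕ) : ℂ)⁻¹) with hs
  have hs2 : ∀ v, s v ^ 2 = v := fun v => Complex.cpow_nat_inv_pow v two_ne_zero
  have hS : IsOpen ((fun ζ : ℂ => ζ ^ 2) ⁻¹' V) := hV.preimage (by fun_prop)
  have hEA : ∀ ζ, ζ ^ 2 ∈ V → E ζ = E (s (ζ ^ 2)) := by
    intro ζ hζ
    rcases sq_eq_sq_iff_eq_or_eq_neg.1 (hs2 (ζ ^ 2)) with h | h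
    · rw [h]
    · rw [h, heven ζ hζ]
  have hEd : ∀ ζ, ζ ^ 2 ∈ V → DifferentiableAt ℂ E ζ := fun ζ hζ =>
    hE.differentiableAt (hS.mem_nhds hζ)
  have hne : ∀ v ∈ V, v ≠ 0 → DifferentiableAt ℂ (fun v => E (s v)) v := by
    intro v hv hv0
    -- A branch of the root holomorphic near v, even when v lies on the cut of the principal branch.
    set g : ℂ → ℂ := fun x => s v * s (x / v) with hg
    have hg2 : ∀ x, g x ^ 2 = x := fun x => by
      simp only [hg, mul_pow, hs2]
      field_simp
    have hgd : DifferentiableAt ℂ g v := by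
      refine DifferentiableAt.const_mul ?_ _
      refine DifferentiableAt.cpow_const (by fun_prop) ?_
      rw [div_self hv0]
      exact Complex.one_mem_slitPlane
    have hcomp : DifferentiableAt ℂ (fun x => E (g x)) v :=
      (hEd (g v) (by rwa [hg2])).comp v hgd
    refine hcomp.congr_of_eventuallyEq ?_
    filter_upwards [hV.mem_nhds hv] with x hx
    rw [hEA (g x) (by rwa [hg2]), hg2]
  refine ⟨fun v => E (s v), fun v hv => DifferentiableAt.differentiableWithinAt ?_, hEA⟩
  rcases eq_or_ne v 0 with rfl | hv0
  · refine (Complex.analyticAt_of_differentiable_on_punctured_nhds_of_continuousAt ?_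
      ?_).differentiableAt
    · filter_upwards [mem_nhdsWithin_of_mem_nhds (hV.mem_nhds hv), self_mem_nhdsWithin]
        with x hx hx0 using hne x hx hx0
    · have hsc : ContinuousAt s 0 := by
        refine Complex.continuousAt_cpow_const_of_re_pos (by simp) ?_
        norm_num
      exact ContinuousAt.comp (hEd (s 0) (by rwa [hs2])).continuousAt hsc
  · exact hne v hv hv0

theorem exists_even_add_odd {V : Set ℂ} (hV : IsOpen V) {h : ℂ → ℂ}
    (hh : DifferentiableOn ℂ h ((fun ζ => ζ ^ 2) ⁻¹' V)) :
    ∃ A B : ℂ → ℂ, DifferentiableOn ℂ A V ∧ DifferentiableOn ℂ B V ∧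
      ∀ ζ, ζ ^ 2 ∈ V → h ζ = A (ζ ^ 2) + ζ * B (ζ ^ 2) := by
  set S : Set ℂ := (fun ζ : ℂ => ζ ^ 2) ⁻¹' V with hSdef
  have hS : IsOpen S := hV.preimage (by fun_prop)
  have hneg : DifferentiableOn ℂ (fun ζ => h (-ζ)) S :=
    hh.comp differentiableOn_id.neg fun ζ hζ => by
      simpa only [hSdef, mem_preimage, id, Pi.neg_apply, neg_sq] using hζ
  set O : ℂ → ℂ := fun ζ => (h ζ - h (-ζ)) / 2 with hO
  have hOd : DifferentiableOn ℂ O S := (hh.sub hneg).div_const 2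
  -- The odd part O vanishes at 0, so its slope at 0 is O(ζ)/ζ off 0, an even function.
  have hsl : DifferentiableOn ℂ (dslope O 0) S := by
    by_cases h0 : (0 : ℂ) ∈ S
    · exact (Complex.differentiableOn_dslope (hS.mem_nhds h0)).2 hOd
    · exact (differentiableOn_dslope_of_notMem h0).2 hOd
  obtain ⟨A, hA, hEA⟩ := exists_comp_sq_of_even hV (E := fun ζ => (h ζ + h (-ζ)) / 2)
    ((hh.add hneg).div_const 2) fun ζ _ => by simp only [neg_neg]; ring
  obtain ⟨B, hB, hEB⟩ := exists_comp_sq_of_even hV hsl fun ζ _ => by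
    rcases eq_or_ne ζ 0 with rfl | h0
    · rw [neg_zero]
    · rw [dslope_of_ne _ h0, dslope_of_ne _ (neg_ne_zero.2 h0), slope_def_field, slope_def_field]
      simp only [hO, neg_zero, neg_neg, sub_zero, sub_self, zero_div]
      field_simp
      ring
  refine ⟨A, B, hA, hB, fun ζ hζ => ?_⟩
  have h1 := sub_smul_dslope O 0 ζ
  rw [← hEA ζ hζ, ← hEB ζ hζ]
  simp only [hO, sub_zero, smul_eq_mul, neg_zero, sub_self, zero_div] at h1
  rw [h1]
  ring

end evenOdd

/-- The Taylor series of Ψ converges to Ψ on every smaller disc, and its coefficients are determined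
by Ψ near 0. -/
theorem hasSum_of_eventually_hasSum {Ψ : ℂ → ℂ} {c : ℕ → ℂ} {R : ℝ}
    (hΨ : DifferentiableOn ℂ Ψ (Metric.ball 0 R))
    (hc : ∀ᶠ u in 𝓝 (0 : ℂ), HasSum (fun n => u ^ n * c n) (Ψ u)) {u : ℂ} (hu : ‖u‖ < R) :
    HasSum (fun n => u ^ n * c n) (Ψ u) := by
  obtain ⟨r, hur, hrR⟩ := exists_between hu
  have hr : 0 < r := (norm_nonneg u).trans_lt hur
  lift r to NNReal using hr.le
  have h1 := (hΨ.mono (Metric.closedBall_subset_ball hrR)).hasFPowerSeriesOnBall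
    (NNReal.coe_pos.1 hr)
  have h2 : HasFPowerSeriesAt Ψ (FormalMultilinearSeries.ofScalars ℂ c) 0 := by
    rw [hasFPowerSeriesAt_iff]
    simpa [FormalMultilinearSeries.coeff_ofScalars] using hc
  rw [h1.hasFPowerSeriesAt.eq_formalMultilinearSeries h2] at h1
  have h3 := h1.hasSum (y := u) (by simpa [← NNReal.coe_lt_coe, enorm_eq_nnnorm] using hur)
  simpa [FormalMultilinearSeries.ofScalars_apply_eq, mul_comm] using h3

/-! ### Summing the two infinite series -/

section series

theorem HasSum.congr_value {c : ℕ → ℂ} {a b : ℂ} (h : HasSum c a) (e : b = a) : HasSum c b :=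
  e ▸ h

variable {f F A B : ℂ → ℂ} {γ : ℝ → ℂ} {z₁ z₂ : ℂ} {R : ℝ}

/-- For small u the equation (z − z₁)(z − z₂) = u has roots z = m + ζ near z₂ and z' = m − ζ near
z₁, where m = (z₁ + z₂)/2, both inside γ. The geometric series sums to the integral of f(w)(w −
z₁)/((w − z)(w − z')); partial fractions express it by F(z) and F(z'), that is by A(u) ± ζB(u), and
ζ cancels. -/
theorem hasSum_dCoeff (hγ : IsSimpleLoop γ) (hf : ContinuousOn f (trace γ)) (h : z₁ ≠ z₂)
    (h₁ : z₁ ∈ inside γ) (h₂ : z₂ ∈ inside γ) (hR : 0 < R)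
    (hF : ∀ z ∈ inside γ, F z =
      1 / (2 * Real.pi * Complex.I) * contourIntegral (fun w => f w / (w - z)) γ)
    (hA : DifferentiableOn ℂ A (Metric.ball 0 R)) (hB : DifferentiableOn ℂ B (Metric.ball 0 R))
    (hAB : ∀ z, ‖(z - z₁) * (z - z₂)‖ < R →
      F z = A ((z - z₁) * (z - z₂)) + (z - (z₁ + z₂) / 2) * B ((z - z₁) * (z - z₂)))
    {u : ℂ} (hu : ‖u‖ < R) :
    HasSum (fun n => u ^ n * dCoeff f γ z₁ z₂ n)
      ((A u + (z₂ - z₁) / 2 * B u) / (z₂ - z₁)) := by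
  have hsub : z₂ - z₁ ≠ 0 := sub_ne_zero.2 h.symm
  have hne₁ : ∀ w ∈ trace γ, w - z₁ ≠ 0 := fun w hw => sub_ne_zero_of_mem_trace hw h₁.1
  have hne₂ : ∀ w ∈ trace γ, w - z₂ ≠ 0 := fun w hw => sub_ne_zero_of_mem_trace hw h₂.1
  refine hasSum_of_eventually_hasSum (Ψ := fun u => (A u + (z₂ - z₁) / 2 * B u) / (z₂ - z₁))
    ((hA.add (hB.const_mul _)).div_const _) ?_ hu
  set q : ℂ → ℂ := fun w => ((w - z₁) * (w - z₂))⁻¹ with hq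
  have hqc : ContinuousOn q (trace γ) := ContinuousOn.inv₀ (by fun_prop) fun w hw =>
    mul_ne_zero (hne₁ w hw) (hne₂ w hw)
  have hkc : ContinuousOn (fun w => f w / (w - z₂)) (trace γ) := continuousOn_div_sub hf h₂.1
  obtain ⟨M, hM⟩ := hγ.isCompact_trace.exists_bound_of_continuousOn hqc
  have hev1 : ∀ᶠ u : ℂ in 𝓝 0, ‖u‖ * M < 1 / 2 := by
    have : Tendsto (fun u : ℂ => ‖u‖ * M) (𝓝 0) (𝓝 (‖(0 : ℂ)‖ * M)) :=
      (continuous_norm.mul continuous_const).tendsto 0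
    exact this.eventually_lt_const (by simp)
  -- A square root of u + ((z₂ − z₁)/2)², normalised so that the principal branch is taken near 1
  -- and σ(0) = (z₂ − z₁)/2.
  set σ : ℂ → ℂ := fun u => (z₂ - z₁) / 2 *
    ((u + ((z₂ - z₁) / 2) ^ 2) / ((z₂ - z₁) / 2) ^ 2) ^ (((2 : ℕ) : ℂ)⁻¹) with hσ
  have hσ2 : ∀ u, σ u ^ 2 = u + ((z₂ - z₁) / 2) ^ 2 := fun u => by
    simp only [hσ]
    rw [mul_pow, Complex.cpow_nat_inv_pow _ two_ne_zero]
    field_simp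
  have hσ0 : σ 0 = (z₂ - z₁) / 2 := by
    simp only [hσ, zero_add]
    rw [div_self (pow_ne_zero _ (div_ne_zero hsub two_ne_zero)), Complex.one_cpow, mul_one]
  have hσc : ContinuousAt σ 0 := by
    refine continuousAt_const.mul (ContinuousAt.cpow (by fun_prop) continuousAt_const ?_)
    rw [zero_add, div_self (pow_ne_zero _ (div_ne_zero hsub two_ne_zero))]
    exact Complex.one_mem_slitPlane
  have hI := isOpen_inside hγ
  have hev2 : ∀ᶠ u in 𝓝 (0 : ℂ), (z₁ + z₂) / 2 + σ u ∈ inside γ := by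
    refine ContinuousAt.eventually_mem (f := fun u => (z₁ + z₂) / 2 + σ u)
      (continuousAt_const.add hσc) (hI.mem_nhds ?_)
    convert h₂ using 1
    rw [hσ0]
    ring
  have hev3 : ∀ᶠ u in 𝓝 (0 : ℂ), (z₁ + z₂) / 2 - σ u ∈ inside γ := by
    refine ContinuousAt.eventually_mem (f := fun u => (z₁ + z₂) / 2 - σ u)
      (continuousAt_const.sub hσc) (hI.mem_nhds ?_)
    convert h₁ using 1
    rw [hσ0]
    ring
  have hev4 : ∀ᶠ u in 𝓝 (0 : ℂ), σ u ≠ 0 :=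
    hσc.eventually_ne (by rw [hσ0]; exact div_ne_zero hsub two_ne_zero)
  filter_upwards [hev1, hev2, hev3, hev4, Metric.ball_mem_nhds (0 : ℂ) hR] with u hu1 hu2 hu3 hu4 hu5
  rw [mem_ball_zero_iff] at hu5
  have hs := (hasSum_contourIntegral_geometric hγ hkc hqc (u := u) (ρ := 1 / 2) (by norm_num)
    fun w hw => by
      rw [norm_mul]
      exact (mul_le_mul_of_nonneg_left (hM w hw) (norm_nonneg u)).trans hu1.le).mul_right
    (1 / (2 * Real.pi * Complex.I * (z₂ - z₁)))
  have hterm : ∀ n, contourIntegral (fun w => f w / (w - z₂) * q w ^ n) γ =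
      contourIntegral (fun w => f w / ((w - z₁) ^ n * (w - z₂) ^ (n + 1))) γ := fun n =>
    contourIntegral_congr fun w hw => by
      simp only [hq, inv_pow, mul_pow, pow_succ]
      have := hne₁ w hw
      have := hne₂ w hw
      field_simp
  have e1 : (fun n => u ^ n * dCoeff f γ z₁ z₂ n) = fun n =>
      u ^ n * contourIntegral (fun w => f w / (w - z₂) * q w ^ n) γ *
        (1 / (2 * Real.pi * Complex.I * (z₂ - z₁))) := by
    funext n
    rw [hterm, dCoeff]
    ring
  rw [e1]
  refine hs.congr_value ?_
  set ζ := σ u with hζ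
  set z := (z₁ + z₂) / 2 + ζ with hz
  set z' := (z₁ + z₂) / 2 - ζ with hz'
  have hpz : (z - z₁) * (z - z₂) = u := by
    have := hσ2 u
    rw [← hζ] at this
    simp only [hz]
    linear_combination this
  have hpz' : (z' - z₁) * (z' - z₂) = u := by
    have := hσ2 u
    rw [← hζ] at this
    simp only [hz']
    linear_combination this
  have hFz := hAB z (by rwa [hpz])
  have hFz' := hAB z' (by rwa [hpz'])
  rw [hpz, hF z hu2, show z - (z₁ + z₂) / 2 = ζ by simp only [hz]; ring] at hFz
  rw [hpz', hF z' hu3, show z' - (z₁ + z₂) / 2 = -ζ by simp only [hz']; ring] at hFz'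
  have hc1 : ContinuousOn (fun w => f w / (w - z)) (trace γ) := continuousOn_div_sub hf hu2.1
  have hc2 : ContinuousOn (fun w => f w / (w - z')) (trace γ) := continuousOn_div_sub hf hu3.1
  have hint : contourIntegral (fun w => f w / (w - z₂) * (1 - u * q w)⁻¹) γ =
      contourIntegral (fun w => f w / (w - z)) γ * ((z - z₁) / (2 * ζ)) -
        contourIntegral (fun w => f w / (w - z')) γ * ((z' - z₁) / (2 * ζ)) := by
    rw [← contourIntegral_mul_const, ← contourIntegral_mul_const, ← contourIntegral_sub hγ
      (g := fun w => f w / (w - z) * ((z - z₁) / (2 * ζ)))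
      (h := fun w => f w / (w - z') * ((z' - z₁) / (2 * ζ)))
      (hc1.mul continuousOn_const) (hc2.mul continuousOn_const)]
    refine contourIntegral_congr fun w hw => ?_
    have n1 := hne₁ w hw
    have n2 := hne₂ w hw
    have n3 : w - z ≠ 0 := sub_ne_zero_of_mem_trace hw hu2.1
    have n4 : w - z' ≠ 0 := sub_ne_zero_of_mem_trace hw hu3.1
    have e2 : 1 - u * q w = (w - z) * (w - z') / ((w - z₁) * (w - z₂)) := by
      rw [eq_div_iff (mul_ne_zero n1 n2)]
      simp only [hq]
      rw [sub_mul, mul_assoc, inv_mul_cancel₀ (mul_ne_zero n1 n2), ← hpz]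
      simp only [hz, hz']
      ring
    simp only [e2, inv_div]
    have e3 : (z - z₁) / (w - z) - (z' - z₁) / (w - z') =
        2 * ζ * (w - z₁) / ((w - z) * (w - z')) := by
      rw [div_sub_div _ _ n3 n4]
      congr 1
      simp only [hz, hz']
      ring
    have e4 : f w / (w - z) * ((z - z₁) / (2 * ζ)) - f w / (w - z') * ((z' - z₁) / (2 * ζ)) =
        f w / (2 * ζ) * ((z - z₁) / (w - z) - (z' - z₁) / (w - z')) := by ring
    rw [e4, e3]
    field_simp
  rw [hint]
  have hπ : (2 * Real.pi * Complex.I : ℂ) ≠ 0 := Complex.two_pi_I_ne_zero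
  have e5 : (contourIntegral (fun w => f w / (w - z)) γ * ((z - z₁) / (2 * ζ)) -
        contourIntegral (fun w => f w / (w - z')) γ * ((z' - z₁) / (2 * ζ))) *
        (1 / (2 * Real.pi * Complex.I * (z₂ - z₁))) =
      ((1 / (2 * Real.pi * Complex.I) * contourIntegral (fun w => f w / (w - z)) γ) * (z - z₁) -
      (1 / (2 * Real.pi * Complex.I) * contourIntegral (fun w => f w / (w - z')) γ) * (z' - z₁)) /
        (2 * ζ * (z₂ - z₁)) := by
    field_simp
  rw [e5, hFz, hFz', div_eq_div_iff hsub (by simp [hu4, hsub])]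
  simp only [hz, hz']
  ring

theorem hasSum_taylorTerm (hγ : IsSimpleLoop γ) (hf : ContinuousOn f (trace γ)) (h : z₁ ≠ z₂)
    (h₁ : z₁ ∈ inside γ) (h₂ : z₂ ∈ inside γ)
    (hF : ∀ z ∈ inside γ, F z =
      1 / (2 * Real.pi * Complex.I) * contourIntegral (fun w => f w / (w - z)) γ)
    (hFd : DifferentiableOn ℂ F {z | ‖(z - z₁) * (z - z₂)‖ < R}) {z : ℂ}
    (hz : ‖(z - z₁) * (z - z₂)‖ < R) :
    HasSum (taylorTerm f γ z₁ z₂ z) (F z) := by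
  have hR : 0 < R := (norm_nonneg _).trans_lt hz
  set d : ℂ := (z₂ - z₁) / 2 with hd
  have hp : ∀ ζ : ℂ, ((z₁ + z₂) / 2 + ζ - z₁) * ((z₁ + z₂) / 2 + ζ - z₂) = ζ ^ 2 - d ^ 2 := by
    intro ζ
    simp only [hd]
    ring
  obtain ⟨A, B, hA, hB, hAB⟩ := exists_even_add_odd (Metric.isOpen_ball (x := d ^ 2) (ε := R))
    (h := fun ζ => F ((z₁ + z₂) / 2 + ζ)) (hFd.comp (by fun_prop) fun ζ hζ => by
      rw [mem_preimage, mem_ball_iff_norm] at hζ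
      simpa only [mem_ofPred_eq, hp] using hζ)
  have hmaps : MapsTo (fun u : ℂ => u + d ^ 2) (Metric.ball 0 R) (Metric.ball (d ^ 2) R) :=
    fun u hu => by simpa [mem_ball_iff_norm] using hu
  have hA' : DifferentiableOn ℂ (fun u => A (u + d ^ 2)) (Metric.ball 0 R) :=
    hA.comp (by fun_prop) hmaps
  have hB' : DifferentiableOn ℂ (fun u => B (u + d ^ 2)) (Metric.ball 0 R) :=
    hB.comp (by fun_prop) hmaps
  have hAB' : ∀ x, ‖(x - z₁) * (x - z₂)‖ < R → F x = A ((x - z₁) * (x - z₂) + d ^ 2) +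
      (x - (z₁ + z₂) / 2) * B ((x - z₁) * (x - z₂) + d ^ 2) := by
    intro x hx
    have e := hp (x - (z₁ + z₂) / 2)
    rw [add_sub_cancel] at e
    have := hAB (x - (z₁ + z₂) / 2) (by rwa [mem_ball_iff_norm, ← e])
    simp only [add_sub_cancel] at this
    rw [this, e, sub_add_cancel]
  have s₁ := hasSum_dCoeff hγ hf h h₁ h₂ hR hF hA' hB' hAB' hz
  -- A and B depend symmetrically on z₁ and z₂, so the same pair serves the interchanged
  -- coefficients.
  have s₂ := hasSum_dCoeff hγ hf h.symm h₂ h₁ hR hF hA' hB'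
    (fun x hx => by
      rw [mul_comm] at hx
      rw [hAB' x hx, mul_comm (x - z₁), add_comm z₁]) hz
  have hs := (s₁.mul_right (z - z₁)).add (s₂.mul_right (z - z₂))
  have hsub : z₂ - z₁ ≠ 0 := sub_ne_zero.2 h.symm
  have hsub' : z₁ - z₂ ≠ 0 := sub_ne_zero.2 h
  have e1 : taylorTerm f γ z₁ z₂ z = fun n =>
      ((z - z₁) * (z - z₂)) ^ n * dCoeff f γ z₁ z₂ n * (z - z₁) +
        ((z - z₁) * (z - z₂)) ^ n * dCoeff f γ z₂ z₁ n * (z - z₂) := by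
    funext n
    simp only [taylorTerm, mul_pow]
    ring
  rw [e1]
  refine hs.congr_value ?_
  rw [hAB' z hz, ← neg_sub z₂ z₁, div_neg]
  generalize A ((z - z₁) * (z - z₂) + d ^ 2) = a
  generalize B ((z - z₁) * (z - z₂) + d ^ 2) = b
  field_simp
  ring

/-- W inverts u = (z − z₂)/(z − z₁), and Ψ(u) = (z − z₁)F(z) at z = W(u) generates the e_n. Since R
may exceed 1, u = 1 (z = ∞) has to be covered too: there the integral I, which equals Ψ wherever
W(u) is outside γ, supplies the continuation. -/
theorem hasSum_laurentTerm (hγ : IsSimpleLoop γ) (hf : ContinuousOn f (trace γ)) (h : z₁ ≠ z₂)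
    (h₂ : z₂ ∉ trace γ ∪ inside γ)
    (hF : ∀ z ∉ trace γ ∪ inside γ, F z =
      -(1 / (2 * Real.pi * Complex.I) * contourIntegral (fun w => f w / (w - z)) γ))
    (hFd : DifferentiableOn ℂ F {z | ‖z - z₂‖ < R * ‖z - z₁‖}) {z : ℂ}
    (hz : ‖z - z₂‖ < R * ‖z - z₁‖) :
    HasSum (laurentTerm f γ z₁ z₂ z) (F z) := by
  have hsub : z₂ - z₁ ≠ 0 := sub_ne_zero.2 h.symm
  have hsub' : z₁ - z₂ ≠ 0 := sub_ne_zero.2 h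
  have hne₂ : ∀ w ∈ trace γ, w - z₂ ≠ 0 := fun w hw =>
    sub_ne_zero_of_mem_trace hw fun h' => h₂ (Or.inl h')
  set W : ℂ → ℂ := fun u => z₁ + (z₂ - z₁) / (1 - u) with hW
  set q : ℂ → ℂ := fun w => (w - z₁) / (w - z₂) with hq
  have hqc : ContinuousOn q (trace γ) := ContinuousOn.div (by fun_prop) (by fun_prop) hne₂
  have hkc : ContinuousOn (fun w => f w / (w - z₂)) (trace γ) :=
    continuousOn_div_sub hf fun h' => h₂ (Or.inl h')
  set c : ℂ := (z₁ - z₂) / (2 * Real.pi * Complex.I) with hc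
  set I : ℂ → ℂ := fun u => c * contourIntegral (fun w => f w / ((w - z₂) - u * (w - z₁))) γ
    with hI
  set Ψ : ℂ → ℂ := fun u => if u = 1 then I 1 else (z₂ - z₁) / (1 - u) * F (W u) with hΨ
  have hone : ∀ {u : ℂ}, u ≠ 1 → 1 - u ≠ 0 := fun hu => sub_ne_zero.2 hu.symm
  have hΨI : ∀ u, u ≠ 1 → W u ∉ trace γ ∪ inside γ → Ψ u = I u := by
    intro u hu hWu
    have hu1 := hone hu
    simp only [hΨ, if_neg hu, hF _ hWu, hI]
    have : contourIntegral (fun w => f w / ((w - z₂) - u * (w - z₁))) γ =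
        1 / (1 - u) * contourIntegral (fun w => f w / (w - W u)) γ := by
      rw [← contourIntegral_const_mul]
      refine contourIntegral_congr fun w hw => ?_
      have e : (w - z₂) - u * (w - z₁) = (1 - u) * (w - W u) := by
        simp only [hW]
        field_simp
        ring
      simp only [e]
      rw [one_div, inv_mul_eq_div, div_div, mul_comm]
    rw [this, hc]
    ring
  obtain ⟨M, hM0, hM⟩ : ∃ M > 0, ∀ w ∈ trace γ ∪ inside γ, ‖w - z₁‖ ≤ M := by
    obtain ⟨M, hM⟩ := (isCompact_trace_union_inside hγ).exists_bound_of_continuousOn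
      (f := fun w => w - z₁) (by fun_prop)
    -- The maximum only makes the bound positive, as a divisor.
    exact ⟨max M 1, by positivity, fun w hw => (hM w hw).trans (le_max_left _ _)⟩
  set ε : ℝ := ‖z₂ - z₁‖ / M with hε
  have hε0 : 0 < ε := div_pos (norm_pos_iff.2 hsub) hM0
  -- A zero would give z₂ − z₁ = (1 − u)(w − z₁), too large for |u − 1| < ε. Taking w inside γ as
  -- well shows that W(u) is outside.
  have hden : ∀ u ∈ Metric.ball (1 : ℂ) ε, ∀ w ∈ trace γ ∪ inside γ,
      (w - z₂) - u * (w - z₁) ≠ 0 := by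
    intro u hu w hw h0
    rw [mem_ball_iff_norm] at hu
    have e : z₂ - z₁ = -(u - 1) * (w - z₁) := by linear_combination -h0
    have : ‖z₂ - z₁‖ ≤ ‖u - 1‖ * M := by
      rw [e, norm_mul, norm_neg]
      exact mul_le_mul_of_nonneg_left (hM w hw) (norm_nonneg _)
    rw [hε, lt_div_iff₀ hM0] at hu
    exact absurd this (not_le.2 hu)
  have hIΨ : EqOn Ψ I (Metric.ball 1 ε) := by
    intro u hu
    rcases eq_or_ne u 1 with rfl | hu1
    · simp only [hΨ, if_true]
    · refine hΨI u hu1 fun h' => hden u hu _ h' ?_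
      simp only [hW]
      have := hone hu1
      field_simp
      ring
  have hId : DifferentiableOn ℂ I (Metric.ball 1 ε) := by
    refine DifferentiableOn.const_mul ?_ _
    refine differentiableOn_contourIntegral hγ Metric.isOpen_ball
      (φ := fun u w => f w / ((w - z₂) - u * (w - z₁))) ?_ fun w hw => ?_
    · refine ContinuousOn.div (hf.comp continuousOn_snd fun x hx => hx.2) (by fun_prop)
        fun x hx => hden _ hx.1 _ (Or.inl hx.2)
    · exact DifferentiableOn.div (by fun_prop) (by fun_prop) fun u hu => hden u hu w (Or.inl hw)
  have hWd : ∀ {u : ℂ}, u ≠ 1 → DifferentiableAt ℂ W u := fun {u} hu =>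
    (DifferentiableAt.div (by fun_prop) (by fun_prop) (hone hu)).const_add z₁
  have hopen : IsOpen {x : ℂ | ‖x - z₂‖ < R * ‖x - z₁‖} :=
    isOpen_lt (by fun_prop) (by fun_prop)
  have hΨd : DifferentiableOn ℂ Ψ (Metric.ball 0 R) := by
    intro u hu
    refine DifferentiableAt.differentiableWithinAt ?_
    rcases eq_or_ne u 1 with rfl | hu1
    · exact (hId.congr hIΨ).differentiableAt (Metric.ball_mem_nhds _ hε0)
    · have hmem : W u ∈ {x : ℂ | ‖x - z₂‖ < R * ‖x - z₁‖} := by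
        have h1 := hone hu1
        have e : W u - z₂ = u * (W u - z₁) := by
          simp only [hW]
          field_simp
          ring
        have hpos : 0 < ‖W u - z₁‖ := by
          simp only [hW, add_sub_cancel_left]
          exact norm_pos_iff.2 (div_ne_zero hsub h1)
        rw [mem_ofPred_eq, e, norm_mul]
        exact mul_lt_mul_of_pos_right (mem_ball_zero_iff.1 hu) hpos
      have hd : DifferentiableAt ℂ (fun u => (z₂ - z₁) / (1 - u) * F (W u)) u :=
        DifferentiableAt.mul (DifferentiableAt.div (by fun_prop) (by fun_prop) (hone hu1))
          ((hFd.differentiableAt (hopen.mem_nhds hmem)).comp u (hWd hu1))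
      refine hd.congr_of_eventuallyEq ?_
      filter_upwards [isOpen_ne.mem_nhds hu1] with v hv
      exact if_neg hv
  have hev : ∀ᶠ u in 𝓝 (0 : ℂ), HasSum (fun n => u ^ n * eCoeff f γ z₁ z₂ n) (Ψ u) := by
    obtain ⟨K, hK⟩ := hγ.isCompact_trace.exists_bound_of_continuousOn hqc
    have hev1 : ∀ᶠ u : ℂ in 𝓝 0, ‖u‖ * K < 1 / 2 := by
      have : Tendsto (fun u : ℂ => ‖u‖ * K) (𝓝 0) (𝓝 (‖(0 : ℂ)‖ * K)) :=
        (continuous_norm.mul continuous_const).tendsto 0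
      exact this.eventually_lt_const (by simp)
    have hev2 : ∀ᶠ u in 𝓝 (0 : ℂ), W u ∈ (trace γ ∪ inside γ)ᶜ := by
      refine (hWd zero_ne_one).continuousAt.eventually_mem
        ((isOpen_compl_trace_union_inside hγ).mem_nhds ?_)
      simpa [hW] using h₂
    filter_upwards [hev1, hev2, isOpen_ne.mem_nhds (zero_ne_one' ℂ)] with u hu1 hu2 hu3
    rw [hΨI u hu3 hu2]
    have hs := (hasSum_contourIntegral_geometric hγ hkc hqc (u := u) (ρ := 1 / 2) (by norm_num)
      fun w hw => by
        rw [norm_mul]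
        exact (mul_le_mul_of_nonneg_left (hK w hw) (norm_nonneg u)).trans hu1.le).mul_left c
    have hterm : ∀ n, contourIntegral (fun w => f w / (w - z₂) * q w ^ n) γ =
        contourIntegral (fun w => (w - z₁) ^ n / (w - z₂) ^ (n + 1) * f w) γ := fun n =>
      contourIntegral_congr fun w hw => by
        simp only [hq, div_pow, pow_succ]
        have := hne₂ w hw
        field_simp
    have e1 : (fun n => u ^ n * eCoeff f γ z₁ z₂ n) = fun n =>
        c * (u ^ n * contourIntegral (fun w => f w / (w - z₂) * q w ^ n) γ) := by
      funext n
      rw [hterm, eCoeff]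
      ring
    have e2 : contourIntegral (fun w => f w / ((w - z₂) - u * (w - z₁))) γ =
        contourIntegral (fun w => f w / (w - z₂) * (1 - u * q w)⁻¹) γ :=
      contourIntegral_congr fun w hw => by
        have e3 : (w - z₂) - u * (w - z₁) = (w - z₂) * (1 - u * q w) := by
          have := hne₂ w hw
          simp only [hq]
          field_simp
        simp only [e3]
        rw [← div_div, div_eq_mul_inv (f w / (w - z₂))]
    rw [e1]
    simp only [hI, e2]
    exact hs
  have hzz : z - z₁ ≠ 0 := by
    intro h0
    rw [h0, norm_zero, mul_zero] at hz
    exact absurd hz (not_lt.2 (norm_nonneg _))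
  have hu : ‖(z - z₂) / (z - z₁)‖ < R := by
    rwa [norm_div, div_lt_iff₀ (norm_pos_iff.2 hzz)]
  have hu1 : (z - z₂) / (z - z₁) ≠ 1 := by
    rw [Ne, div_eq_one_iff_eq hzz, sub_right_inj]
    exact h.symm
  have hs := (hasSum_of_eventually_hasSum hΨd hev hu).mul_right (1 / (z - z₁))
  have e1 : laurentTerm f γ z₁ z₂ z = fun n =>
      ((z - z₂) / (z - z₁)) ^ n * eCoeff f γ z₁ z₂ n * (1 / (z - z₁)) := by
    funext n
    simp only [laurentTerm, div_pow, pow_succ]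
    field_simp
  rw [e1]
  refine hs.congr_value ?_
  have e2 : 1 - (z - z₂) / (z - z₁) = (z₂ - z₁) / (z - z₁) := by
    field_simp
    ring
  have e3 : (z₂ - z₁) / (1 - (z - z₂) / (z - z₁)) = z - z₁ := by
    rw [e2]
    field_simp
  simp only [hΨ, if_neg hu1, hW, e3, add_sub_cancel]
  field_simp

end series

/-! ### Convergence and the main theorem -/

theorem AdmissibleContours.hasSum_of_mem_convergenceRegion {Ω Ω₀ : Set ℂ} {f : ℂ → ℂ}
    {C₁ C₂ : ℝ → ℂ} {z₁ z₂ z : ℂ} (hΩ : IsOpen Ω) (hΩ₀ : IsClosed Ω₀)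
    (hf : DifferentiableOn ℂ f (Ω \ Ω₀)) (hz₁ : z₁ ∈ Ω₀) (hz₂ : z₂ ∈ Ω \ Ω₀)
    (h : AdmissibleContours Ω Ω₀ {z₂} C₁ C₂) (hz : z ∈ convergenceRegion Ω Ω₀ z₁ z₂) :
    ∃ a b : ℂ, HasSum (taylorTerm f C₁ z₁ z₂ z) a ∧ HasSum (laurentTerm f C₂ z₁ z₂ z) b ∧
      f z = a + b := by
  obtain ⟨hzΩ, hr₁, hr₂⟩ := hz
  obtain ⟨F₁, F₂, hd₁, hd₂, hsum, hF₁, hF₂⟩ := h.exists_splitting hΩ hΩ₀ hf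
  have hne : z₁ ≠ z₂ := fun e => hz₂.2 (e ▸ hz₁)
  have hzz : z - z₁ ≠ 0 := sub_ne_zero.2 fun e => hzΩ.2 (e ▸ hz₁)
  refine ⟨F₁ z, F₂ z, ?_, ?_, hsum z hzΩ⟩
  -- A finite R below r₁, which may be ∞; a point outside Ω with |(w − z₁)(w − z₂)| < R would
  -- contradict the infimum.
  · obtain ⟨R, hzR, hR⟩ := ENNReal.lt_iff_exists_nnreal_btwn.1 hr₁
    refine hasSum_taylorTerm (R := R) h.loop₁ (hf.continuousOn.mono h.trace₁) hne
      (h.core_subset_inside₁ hz₁) (h.points₁ rfl) hF₁ (hd₁.mono fun w hw => ?_) ?_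
    · by_contra hwΩ
      have h1 : cassiniRadius Ω z₁ z₂ ≤ ‖(w - z₁) * (w - z₂)‖ₑ := iInf₂_le w hwΩ
      have h2 : ‖(w - z₁) * (w - z₂)‖ₑ < R := by
        rw [enorm_eq_nnnorm, ENNReal.coe_lt_coe]
        exact hw
      exact lt_irrefl _ (hR.trans_le (h1.trans h2.le))
    · rw [enorm_eq_nnnorm, ENNReal.coe_lt_coe] at hzR
      exact hzR
  · have hz0 : ‖z - z₁‖ₑ ≠ 0 := enorm_ne_zero.2 hzz
    have hr₂' : ‖z - z₂‖ₑ / ‖z - z₁‖ₑ < quotientRadius Ω₀ z₁ z₂ :=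
      (ENNReal.div_lt_iff (Or.inl hz0) (Or.inl enorm_ne_top)).2 hr₂
    obtain ⟨R, hzR, hR⟩ := ENNReal.lt_iff_exists_nnreal_btwn.1 hr₂'
    have hiff : ∀ w : ℂ, w - z₁ ≠ 0 →
        (‖w - z₂‖ₑ / ‖w - z₁‖ₑ < R ↔ ‖w - z₂‖ < R * ‖w - z₁‖) := by
      intro w hw
      rw [ENNReal.div_lt_iff (Or.inl (enorm_ne_zero.2 hw)) (Or.inl enorm_ne_top),
        enorm_eq_nnnorm, enorm_eq_nnnorm, ← ENNReal.coe_mul, ENNReal.coe_lt_coe,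
        ← NNReal.coe_lt_coe, NNReal.coe_mul, coe_nnnorm, coe_nnnorm]
    refine hasSum_laurentTerm (R := R) h.loop₂ (hf.continuousOn.mono h.trace₂) hne
      (h.notMem_outside₂ rfl) hF₂ (hd₂.mono fun w hw hw₀ => ?_) ((hiff z hzz).1 hzR)
    have hw' : ‖w - z₂‖ < R * ‖w - z₁‖ := hw
    have hwz : w - z₁ ≠ 0 := by
      intro h0
      rw [h0, norm_zero, mul_zero] at hw'
      exact absurd hw' (not_lt.2 (norm_nonneg _))
    have h1 : quotientRadius Ω₀ z₁ z₂ ≤ ‖w - z₂‖ₑ / ‖w - z₁‖ₑ := iInf₂_le w hw₀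
    exact lt_irrefl _ (hR.trans_le (h1.trans ((hiff w hwz).2 hw').le))

theorem theorem3 (Ω Ω₀ : Set ℂ) (hΩ : IsOpen Ω) (hΩ₀ : IsClosed Ω₀) (hsub : Ω₀ ⊆ Ω)
    (f : ℂ → ℂ) (hf : AnalyticOnNhd ℂ f (Ω \ Ω₀))
    (z₁ z₂ : ℂ) (hz₁ : z₁ ∈ Ω₀) (hz₂ : z₂ ∈ Ω \ Ω₀)
    (C₁ C₂ : ℝ → ℂ) (hC : AdmissibleContours Ω Ω₀ {z₂} C₁ C₂) :
    -- the coefficients do not depend on the contours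
    (∀ Γ₁ Γ₂ : ℝ → ℂ, AdmissibleContours Ω Ω₀ {z₂} Γ₁ Γ₂ → ∀ n : ℕ,
      dCoeff f Γ₁ z₁ z₂ n = dCoeff f C₁ z₁ z₂ n ∧
      dCoeff f Γ₁ z₂ z₁ n = dCoeff f C₁ z₂ z₁ n ∧
      eCoeff f Γ₂ z₁ z₂ n = eCoeff f C₂ z₁ z₂ n) ∧
    -- the expansion with remainder
    (∀ z ∈ Ω \ Ω₀, ∀ Γ₁ Γ₂ : ℝ → ℂ, AdmissibleContours Ω Ω₀ {z, z₂} Γ₁ Γ₂ → ∀ N : ℕ,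
      f z = ∑ n ∈ Finset.range N, taylorTerm f C₁ z₁ z₂ z n +
        ∑ n ∈ Finset.range N, laurentTerm f C₂ z₁ z₂ z n +
        remainder f Γ₁ Γ₂ z₁ z₂ z N) ∧
    -- convergence
    (∀ z ∈ convergenceRegion Ω Ω₀ z₁ z₂,
      Summable (taylorTerm f C₁ z₁ z₂ z) ∧ Summable (laurentTerm f C₂ z₁ z₂ z) ∧
      f z = ∑' n, taylorTerm f C₁ z₁ z₂ z n + ∑' n, laurentTerm f C₂ z₁ z₂ z n ∧
      ∀ Γ₁ Γ₂ : ℝ → ℂ, AdmissibleContours Ω Ω₀ {z, z₂} Γ₁ Γ₂ →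
        Tendsto (remainder f Γ₁ Γ₂ z₁ z₂ z) atTop (𝓝 0)) := by
  have hfd : DifferentiableOn ℂ f (Ω \ Ω₀) := hf.differentiableOn
  have hexp := fun z (hz : z ∈ Ω \ Ω₀) Γ₁ Γ₂
      (h : AdmissibleContours Ω Ω₀ {z, z₂} Γ₁ Γ₂) (N : ℕ) =>
    h.expansion hΩ hΩ₀ hfd hz₁ hz hz₂ hC N
  refine ⟨fun Γ₁ Γ₂ h n => AdmissibleContours.coeff_eq hΩ hΩ₀ hfd hz₁ h hC n, hexp,
    fun z hz => ?_⟩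
  obtain ⟨a, b, ha, hb, hab⟩ := hC.hasSum_of_mem_convergenceRegion hΩ hΩ₀ hfd hz₁ hz₂ hz
  refine ⟨ha.summable, hb.summable, by rw [ha.tsum_eq, hb.tsum_eq, hab], fun Γ₁ Γ₂ h => ?_⟩
  -- By the finite expansion r_N is f(z) minus the partial sums, so no estimate of its integrals is
  -- needed.
  have hlim := (ha.tendsto_sum_nat.add hb.tendsto_sum_nat).const_sub (f z)
  rw [← hab, sub_self] at hlim
  refine hlim.congr fun N => ?_
  linear_combination hexp z hz.1 Γ₁ Γ₂ h N
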